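/- Let $\mathbb{T}^3=\mathbb{R}^3/(2\pi\mathbb{Z})^3$, $\nu>0$, $T>0$, let $\|\cdot\|$ and $(\cdot,\cdot)$ be the norm and scalar product of $L^2(\mathbb{T}^3)$, and let $H$ and $V$ be the closures, in $L^2(\mathbb{T}^3)$ and in $W^{1,2}(\mathbb{T}^3)$ respectively, of the smooth, periodic, divergence-free vector fields with zero mean value. Let $v_0\in H$. A measurable $v:(0,T)\times\mathbb{T}^3\to\mathbb{R}^3$ is called a Leray–Hopf weak solution of the Navier–Stokes equations with viscosity $\nu$ and initial datum $v_0$ if $v\in L^\infty(0,T;H)\cap L^2(0,T;V)$ and the following hold, where $v$ denotes, as usual, the representative (defined for all $t\in[0,T]$) that is weakly continuous from $[0,T]$ to $L^2(\mathbb{T}^3)$, with $v(t)\in H$ for every $t\in[0,T]$: 1. for every $\varphi\in C_0^\infty([0,T)\times\mathbb{T}^3;\mathbb{R}^3)$ with $\operatorname{div}\varphi=0$ (so $\varphi$ need not vanish at $t=0$), $$\int_0^T\big[(v,\partial_t\varphi)-\nu(\nabla v,\nabla\varphi)-((v\cdot\nabla)v,\varphi)\big]\,dt=-(v_0,\varphi(0));$$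 2. $\displaystyle \tfrac12\|v(t)\|^2+\nu\int_0^t\|\nabla v(\tau)\|^2\,d\tau\le\tfrac12\|v_0\|^2$ for all $t\in[0,T]$; 3. $\lim_{t\to0^+}\|v(t)-v_0\|=0$. **Theorem.** Let $v$ be such a Leray–Hopf weak solution, let $\alpha\in(0,1)$, and suppose that $v\in L^{2/(1+\alpha)}(\lambda,T;\dot C^{\alpha}(\mathbb{T}^3))$ for every $\lambda\in(0,T)$; that is, for every $\lambda\in(0,T)$ there is a function $f:(\lambda,T)\to[0,\infty)$ with $\int_\lambda^T f(t)^{2/(1+\alpha)}\,dt<\infty$ such that, for almost every $t\in(\lambda,T)$, $|v(t,x)-v(t,y)|\le f(t)\,|x-y|^\alpha$ for all $x,y$ (no integrability of $f$ up to $t=0$ is required). Then $v$ satisfies the energy equality on $[0,T]$: $$\tfrac12\|v(t)\|^2+\nu\int_0^t\|\nabla v(\tau)\|^2\,d\tau=\tfrac12\|v_0\|^2\qquad\text{for all }t\in[0,T].$$ -/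

import Mathlib

open MeasureTheory Set Filter Topology
open scoped ContDiff ENNReal

noncomputable section

namespace TorusNS

/-- Euclidean three-space. The torus is `ℝ³ / (2π ℤ)³`: functions on it are the functions on `ℝ³`
that are `2π`-periodic in each coordinate, and integrals are taken over one period cell. -/
abbrev E3 : Type := EuclideanSpace ℝ (Fin 3)

/-- The `i`-th vector of the standard basis. -/
def e (i : Fin 3) : E3 := EuclideanSpace.single i (1 : ℝ)

/-- A function on the torus: `2π`-periodic in each coordinate direction. -/
def SpacePeriodic {F : Type*} (u : E3 → F) : Prop :=
  ∀ (x : E3) (i : Fin 3), u (x + (2 * Real.pi) • e i) = u x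

/-- The period cell `[-π, π)³`. -/
def cell : Set E3 := {x | ∀ i, x i ∈ Ico (-Real.pi) Real.pi}

/-- Lebesgue measure on the torus. -/
def μT : Measure E3 := volume.restrict cell

/-- The square of the `L²(𝕋³)` norm. -/
def normSq (u : E3 → E3) : ℝ := ∫ x, ‖u x‖ ^ 2 ∂μT

/-- The `L²(𝕋³)` scalar product. -/
def scal (u w : E3 → E3) : ℝ := ∫ x, inner ℝ (u x) (w x) ∂μT

/-- The scalar product `A : B = ∑ᵢⱼ Aᵢⱼ Bᵢⱼ` of matrices, written columnwise. -/
def frob (A B : E3 →L[ℝ] E3) : ℝ := ∑ j, inner ℝ (A (e j)) (B (e j))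

/-- The `L²(𝕋³)` scalar product of matrix fields. -/
def scalMat (A B : E3 → E3 →L[ℝ] E3) : ℝ := ∫ x, frob (A x) (B x) ∂μT

/-- The classical divergence. -/
def divergence (w : E3 → E3) (x : E3) : ℝ := ∑ j, (fderiv ℝ w x (e j)) j

/-- Smooth, periodic, divergence-free vector fields with zero mean value. -/
structure SmoothSolenoidal (w : E3 → E3) : Prop where
  smooth : ContDiff ℝ ∞ w
  periodic : SpacePeriodic w
  div_free : ∀ x, divergence w x = 0
  mean_zero : ∫ x, w x ∂μT = 0

/-- The space `H`: the closure in `L²(𝕋³)` of the smooth, periodic, divergence-free vector fields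
with zero mean value. -/
structure MemH (u : E3 → E3) : Prop where
  periodic : SpacePeriodic u
  memLp : MemLp u 2 μT
  approx : ∀ ε : ℝ≥0∞, 0 < ε → ∃ w, SmoothSolenoidal w ∧
    eLpNorm (fun x => u x - w x) 2 μT ≤ ε

/-- `A` is the weak gradient (Jacobian matrix) of the vector field `u` on the torus:
`∫ (∂ⱼψ) u = - ∫ ψ (∂ⱼu)` with `∂ⱼu = A eⱼ`, for all smooth periodic `ψ`. -/
def HasWeakGradient (u : E3 → E3) (A : E3 → E3 →L[ℝ] E3) : Prop :=
  ∀ ψ : E3 → ℝ, ContDiff ℝ ∞ ψ → SpacePeriodic ψ → ∀ j : Fin 3,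
    ∫ x, (fderiv ℝ ψ x (e j)) • u x ∂μT = - ∫ x, ψ x • A x (e j) ∂μT

/-- `u` belongs to `V`, the closure in `W^{1,2}(𝕋³)` of the smooth, periodic, divergence-free vector
fields with zero mean value, and `A` is the weak gradient of `u`. -/
structure MemV (u : E3 → E3) (A : E3 → E3 →L[ℝ] E3) : Prop where
  periodic : SpacePeriodic u
  periodic_grad : SpacePeriodic A
  memLp : MemLp u 2 μT
  memLp_grad : MemLp A 2 μT
  weakGradient : HasWeakGradient u A
  approx : ∀ ε : ℝ≥0∞, 0 < ε → ∃ w, SmoothSolenoidal w ∧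
    eLpNorm (fun x => u x - w x) 2 μT ≤ ε ∧
    eLpNorm (fun x => A x - fderiv ℝ w x) 2 μT ≤ ε

/-- Divergence-free test functions in `C₀^∞([0,T) × 𝕋³)`: they need not vanish at `t = 0`, but they
vanish for `t` near `T`. -/
structure IsTestFunction (T : ℝ) (φ : ℝ → E3 → E3) : Prop where
  smooth : ContDiff ℝ ∞ (fun p : ℝ × E3 => φ p.1 p.2)
  periodic : ∀ t, SpacePeriodic (φ t)
  div_free : ∀ t x, divergence (φ t) x = 0
  vanish : ∃ T' < T, ∀ t, T' ≤ t → ∀ x, φ t x = 0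

/-- `v` is a Leray–Hopf weak solution on `(0,T) × 𝕋³` of the Navier–Stokes equations with viscosity
`ν` and initial datum `v₀`, and `Dv t` is the weak spatial gradient of `v t`. As usual `v` is the
representative that is weakly continuous from `[0,T]` to `L²`. -/
structure IsLerayHopf (ν T : ℝ) (v₀ : E3 → E3) (v : ℝ → E3 → E3)
    (Dv : ℝ → E3 → E3 →L[ℝ] E3) : Prop where
  measurable : AEStronglyMeasurable (fun p : ℝ × E3 => v p.1 p.2)
    ((volume.restrict (Ioo 0 T)).prod μT)
  /-- `v(t)` is in `H` -/
  memH : ∀ t ∈ Icc 0 T, MemH (v t)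
  /-- `v ∈ L^∞(0,T;H)` -/
  bounded : ∃ C : ℝ, ∀ᵐ t ∂(volume.restrict (Ioo 0 T)), normSq (v t) ≤ C
  /-- `v ∈ L²(0,T;V)`, first part: `v(t) ∈ V` with gradient `Dv t` -/
  memV : ∀ᵐ t ∂(volume.restrict (Ioo 0 T)), MemV (v t) (Dv t)
  /-- `v ∈ L²(0,T;V)`, second part: the gradient is in `L²((0,T) × 𝕋³)` -/
  memLp_grad : MemLp (fun p : ℝ × E3 => Dv p.1 p.2) 2 ((volume.restrict (Ioo 0 T)).prod μT)
  /-- weak continuity in `L²` on `[0,T]` -/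
  weak_cont : ∀ g : E3 → E3, MemLp g 2 μT → ContinuousOn (fun t => scal (v t) g) (Icc 0 T)
  /-- the weak form of the equations; `Dv t x (v t x)` is `(v · ∇) v` -/
  weak_form : ∀ φ, IsTestFunction T φ →
    ∫ t in Ioo 0 T, (scal (v t) (fun x => deriv (fun s => φ s x) t)
      - ν * scalMat (Dv t) (fun x => fderiv ℝ (φ t) x)
      - scal (fun x => Dv t x (v t x)) (φ t)) = - scal v₀ (φ 0)
  /-- the energy inequality -/
  energy_le : ∀ t ∈ Icc 0 T,
    (1 / 2) * normSq (v t) + ν * ∫ τ in Ioo 0 t, scalMat (Dv τ) (Dv τ) ≤ (1 / 2) * normSq v₀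
  /-- the initial datum is strongly attained -/
  initial : Tendsto (fun t => normSq (fun x => v t x - v₀ x)) (𝓝[>] 0) (𝓝 0)

/-- `v ∈ L^β(a,b; Ċ^α(𝕋³))`: for almost every `t` the field `v t` is `α`-Hölder with a constant
`f t`, where `f ^ β` is integrable. -/
def MemLpHolder (β α a b : ℝ) (v : ℝ → E3 → E3) : Prop :=
  ∃ f : ℝ → ℝ, (∀ t, 0 ≤ f t) ∧
    (∀ᵐ t ∂(volume.restrict (Ioo a b)), ∀ x y : E3, ‖v t x - v t y‖ ≤ f t * ‖x - y‖ ^ α) ∧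
    IntegrableOn (fun t => f t ^ β) (Ioo a b)

/-- The energy equality on `[0,T]`. -/
def EnergyEquality (ν T : ℝ) (v₀ : E3 → E3) (v : ℝ → E3 → E3)
    (Dv : ℝ → E3 → E3 →L[ℝ] E3) : Prop :=
  ∀ t ∈ Icc 0 T,
    (1 / 2) * normSq (v t) + ν * ∫ τ in Ioo 0 t, scalMat (Dv τ) (Dv τ) = (1 / 2) * normSq v₀

end TorusNS

end

/-!
The flux of kinetic energy through a length scale `r` is cubic in the velocity differences over
distances at most `r`, and the Hölder condition is exactly what makes it vanish as `r → 0`.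

For an even mollifier `k` of radius `r` let `k * v` be the mollified velocity. It is smooth and
solenoidal, so the weak form of the equations may be tested with `k * v(t)` for every fixed `t`
(`IsLerayHopf.scal_eq_sub_integral`). The pairing `(v(s), k * v(t))` is symmetric in `s` and `t`
and absolutely continuous in `s`; summing its increments along a staircase gives its evolution along
the diagonal (`diagonal_increment`), hence the balance
`(v, k * v) |_a^b = -2 ∫_a^b [ν (∇v, ∇(k * v)) + ((v · ∇)v, k * v)] ds`
(`IsLerayHopf.mollified_energy`). No regularisation in time is needed.

The last term is the flux. For a continuous field in `V` it has the Duchon–Robert form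
`4 ((v · ∇)v, k * v) = ∫ ∇k(y) · ∫ δ_y v |δ_y v|² dx dy`, where `δ_y v = v(· + y) - v`
(`MemV.four_mul_flux`). If `v(s)` is `α`-Hölder with constant `f`, one factor `δ_y v` is at most
`f r^α`; the square of the `L²` norm of `δ_y v` is at most both `4 ‖v‖²` and `r² ‖∇v‖²`. As
`∫ |∇k| ≤ C / r`, the flux is at most `C r^(α - 1) f min (4 ‖v‖², r² ‖∇v‖²)`. For fixed `s` this
tends to zero with `r`, and it is bounded, uniformly in `r`, by a multiple of
`f ‖∇v‖^(1 - α) ≤ f^(2 / (1 + α)) + ‖∇v‖²` (`rpow_mul_min_le`), which is integrable in time. Dominated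
convergence yields the energy equality between two positive times (`IsLerayHopf.energy_increment`).
Letting the earlier time tend to zero and using that the initial datum is attained strongly gives
the equality on `[0, T]`.
-/

noncomputable section

namespace TorusNS

/-! ### The torus as a measure space -/

/-- The translation `∑ᵢ 2π nᵢ eᵢ` by a vector of the period lattice. -/
def latticeHom : (Fin 3 → ℤ) →+ E3 where
  toFun n := WithLp.toLp 2 fun i => (n i : ℝ) * (2 * Real.pi)
  map_zero' := by ext i; simp
  map_add' m n := by ext i; simp [add_mul]

/-- The period lattice `(2πℤ)³`. -/
def lattice : AddSubgroup E3 := latticeHom.range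

instance : Countable lattice :=
  (latticeHom.rangeRestrict_surjective).countable

theorem SpacePeriodic.zsmul {F : Type*} {u : E3 → F} (hu : SpacePeriodic u) (n : ℤ) (i : Fin 3)
    (x : E3) : u (x + n • ((2 * Real.pi) • e i)) = u x := by
  have h : Function.Periodic u ((2 * Real.pi) • e i) := fun x => hu x i
  exact h.zsmul n x

theorem SpacePeriodic.add_lattice {F : Type*} {u : E3 → F} (hu : SpacePeriodic u) (g : lattice)
    (x : E3) : u (x + g) = u x := by
  obtain ⟨_, n, rfl⟩ := g
  have : (latticeHom n : E3) = n 0 • ((2 * Real.pi) • e 0) + n 1 • ((2 * Real.pi) • e 1)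
      + n 2 • ((2 * Real.pi) • e 2) := by
    ext i
    fin_cases i <;> simp [latticeHom, e]
  simp only [this, ← add_assoc, hu.zsmul]

/-- The representative in the period cell of a point of `ℝ³` modulo the period lattice. -/
def wrap (x : E3) : E3 := WithLp.toLp 2 fun i => toIcoMod Real.two_pi_pos (-Real.pi) (x i)

theorem wrap_mem_cell (x : E3) : wrap x ∈ cell := by
  intro i
  have := toIcoMod_mem_Ico Real.two_pi_pos (-Real.pi) (x i)
  simpa [wrap, two_mul] using this

theorem wrap_eq_self {x : E3} (hx : x ∈ cell) : wrap x = x := by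
  ext i
  have := hx i
  simp only [wrap]
  rw [toIcoMod_eq_self]
  have h : -Real.pi + 2 * Real.pi = Real.pi := by ring
  rwa [h]

theorem wrap_eq_add_lattice (x : E3) : ∃ g : lattice, wrap x = x + g := by
  refine ⟨⟨latticeHom fun i => -toIcoDiv Real.two_pi_pos (-Real.pi) (x i), _, rfl⟩, ?_⟩
  ext i
  simp [wrap, latticeHom, toIcoMod, sub_eq_add_neg]

theorem spacePeriodic_wrap : SpacePeriodic wrap := by
  intro x i
  ext j
  simp only [wrap, PiLp.add_apply, PiLp.smul_apply, e]
  by_cases h : j = i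
  · subst h
    simp [toIcoMod_add_right]
  · simp [h]

theorem SpacePeriodic.comp_wrap {F : Type*} {u : E3 → F} (hu : SpacePeriodic u) (x : E3) :
    u (wrap x) = u x := by
  obtain ⟨g, hg⟩ := wrap_eq_add_lattice x
  rw [hg, hu.add_lattice]

theorem measurable_wrap : Measurable wrap := by
  refine (WithLp.measurable_toLp 2 _).comp (measurable_pi_lambda _ fun i => ?_)
  have h : (fun x : E3 => toIcoMod Real.two_pi_pos (-Real.pi) (x i)) =
      fun x : E3 => x i - (⌊(x i - (-Real.pi)) / (2 * Real.pi)⌋ : ℝ) * (2 * Real.pi) := by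
    funext x
    simp [toIcoMod, toIcoDiv_eq_floor]
  have hm : Measurable fun x : E3 => x i := by fun_prop
  rw [h]
  refine hm.sub (Measurable.mul_const ?_ _)
  exact (measurable_from_top (f := fun n : ℤ => (n : ℝ))).comp
    (Int.measurable_floor.comp ((hm.sub_const _).div_const _))

theorem measurableSet_cell : MeasurableSet cell := by
  have : cell = ⋂ i, (fun x : E3 => x i) ⁻¹' Ico (-Real.pi) Real.pi := by
    ext x; simp [cell]
  rw [this]
  exact MeasurableSet.iInter fun i => (by fun_prop : Measurable fun x : E3 => x i) measurableSet_Ico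

/-- Every translate of the period cell is a fundamental domain of the period lattice. -/
theorem isAddFundamentalDomain_add_cell (y : E3) :
    IsAddFundamentalDomain lattice {x | x - y ∈ cell} (volume : Measure E3) := by
  refine IsAddFundamentalDomain.mk'
    ((measurable_id.sub_const y) measurableSet_cell).nullMeasurableSet fun x => ?_
  obtain ⟨g, hg⟩ := wrap_eq_add_lattice (x - y)
  refine ⟨g, ?_, ?_⟩
  · change (g : E3) + x - y ∈ cell
    have : (g : E3) + x - y = wrap (x - y) := by rw [hg]; abel
    rw [this]
    exact wrap_mem_cell _
  · rintro g' hg'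
    change (g' : E3) + x - y ∈ cell at hg'
    have h1 := wrap_eq_self hg'
    have h2 : wrap ((g' : E3) + x - y) = wrap (x - y) := by
      rw [← spacePeriodic_wrap.add_lattice g' (x - y)]
      congr 1; abel
    rw [h2, hg] at h1
    apply Subtype.ext
    have h3 : (x - y) + (g' : E3) = x - y + g := by rw [h1]; abel
    exact add_left_cancel h3

theorem isAddFundamentalDomain_cell :
    IsAddFundamentalDomain lattice cell (volume : Measure E3) := by
  simpa using isAddFundamentalDomain_add_cell 0

theorem cell_subset_closedBall : cell ⊆ Metric.closedBall (0 : E3) (3 * Real.pi) := by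
  intro x hx
  rw [mem_closedBall_zero_iff]
  have hπ := Real.pi_pos
  rw [EuclideanSpace.norm_eq, Real.sqrt_le_left (by positivity), Fin.sum_univ_three]
  have h : ∀ i, ‖x i‖ ^ 2 ≤ Real.pi ^ 2 := fun i => by
    have := hx i
    rw [Real.norm_eq_abs, sq_abs]
    exact sq_le_sq' this.1 this.2.le
  nlinarith [h 0, h 1, h 2]

theorem ball_subset_cell : Metric.closedBall (0 : E3) 1 ⊆ cell := by
  intro x hx i
  rw [mem_closedBall_zero_iff] at hx
  have h := (PiLp.norm_apply_le x i).trans hx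
  rw [Real.norm_eq_abs, abs_le] at h
  have := Real.pi_gt_three
  constructor <;> linarith [h.1, h.2]

instance : IsFiniteMeasure μT := by
  refine ⟨?_⟩
  rw [μT, Measure.restrict_apply_univ]
  exact (measure_mono cell_subset_closedBall).trans_lt measure_closedBall_lt_top

/-- A null set of the torus lifts to a null set of `ℝ³`. -/
theorem quasiMeasurePreserving_wrap : Measure.QuasiMeasurePreserving wrap volume μT := by
  refine ⟨measurable_wrap, ?_⟩
  refine Measure.AbsolutelyContinuous.mk fun s hs h0 => ?_
  rw [Measure.map_apply measurable_wrap hs]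
  refine isAddFundamentalDomain_cell.measure_zero_of_invariant _ (fun g => ?_) ?_
  · ext x
    rw [mem_vadd_set_iff_neg_vadd_mem]
    change wrap ((-g : lattice) + x) ∈ s ↔ wrap x ∈ s
    rw [add_comm, spacePeriodic_wrap.add_lattice]
  · rw [μT, Measure.restrict_apply hs] at h0
    refine measure_mono_null (fun x hx => ?_) h0
    have hx1 := hx.1
    rw [mem_preimage, wrap_eq_self hx.2] at hx1
    exact ⟨hx1, hx.2⟩

/-- Translations preserve the measure of the torus. -/
theorem measurePreserving_wrap_add (y : E3) :
    MeasurePreserving (fun x => wrap (x + y)) μT μT := by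
  have hm : Measurable fun x => wrap (x + y) := measurable_wrap.comp (measurable_id.add_const y)
  refine ⟨hm, Measure.ext fun s hs => ?_⟩
  rw [Measure.map_apply hm hs, μT, Measure.restrict_apply hs, Measure.restrict_apply (hm hs)]
  have hA : MeasurableSet (wrap ⁻¹' s) := measurable_wrap hs
  have h1 : s ∩ cell = wrap ⁻¹' s ∩ cell := by
    ext x
    simp only [mem_inter_iff, mem_preimage]
    refine and_congr_left fun hx => ?_
    rw [wrap_eq_self hx]
  have h2 : (fun x => wrap (x + y)) ⁻¹' s ∩ cell =
      (fun x => x + y) ⁻¹' (wrap ⁻¹' s ∩ {x | x - y ∈ cell}) := by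
    ext x; simp
  rw [h1, h2, measure_preimage_add_right]
  refine (isAddFundamentalDomain_add_cell y).measure_set_eq isAddFundamentalDomain_cell hA
    fun g => ?_
  ext x
  change wrap ((g : E3) + x) ∈ s ↔ wrap x ∈ s
  rw [add_comm, spacePeriodic_wrap.add_lattice]

theorem SpacePeriodic.add_right {F : Type*} {u : E3 → F} (hu : SpacePeriodic u) (y : E3) :
    SpacePeriodic fun x => u (x + y) := by
  intro x i
  change u (x + (2 * Real.pi) • e i + y) = u (x + y)
  rw [add_right_comm, hu]

section Periodic

variable {F : Type*} [NormedAddCommGroup F] {u : E3 → F}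

theorem SpacePeriodic.aestronglyMeasurable (hu : SpacePeriodic u)
    (h : AEStronglyMeasurable u μT) : AEStronglyMeasurable u volume := by
  have := h.comp_quasiMeasurePreserving quasiMeasurePreserving_wrap
  exact this.congr (Eventually.of_forall fun x => hu.comp_wrap x)

theorem SpacePeriodic.integrable_add_right (hu : SpacePeriodic u) (h : Integrable u μT) (y : E3) :
    Integrable (fun x => u (x + y)) μT := by
  have := (measurePreserving_wrap_add y).integrable_comp_of_integrable h
  exact this.congr (Eventually.of_forall fun x => hu.comp_wrap _)

theorem SpacePeriodic.memLp_add_right (hu : SpacePeriodic u) {p : ℝ≥0∞} (h : MemLp u p μT)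
    (y : E3) : MemLp (fun x => u (x + y)) p μT := by
  have := h.comp_measurePreserving (measurePreserving_wrap_add y)
  exact this.ae_eq (Eventually.of_forall fun x => hu.comp_wrap _)

theorem SpacePeriodic.eLpNorm_add_right (hu : SpacePeriodic u) {p : ℝ≥0∞}
    (h : AEStronglyMeasurable u μT) (y : E3) :
    eLpNorm (fun x => u (x + y)) p μT = eLpNorm u p μT := by
  rw [← eLpNorm_comp_measurePreserving h (measurePreserving_wrap_add y)]
  exact eLpNorm_congr_ae (Eventually.of_forall fun x => (hu.comp_wrap _).symm)

theorem SpacePeriodic.integral_add_right [NormedSpace ℝ F] (hu : SpacePeriodic u) (y : E3) :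
    ∫ x, u (x + y) ∂μT = ∫ x, u x ∂μT := by
  have h1 : ∫ x, u (x + y) ∂μT = ∫ x in {x | x - y ∈ cell}, u x := by
    have h := (measurePreserving_add_right (volume : Measure E3) y).setIntegral_preimage_emb
      (MeasurableEquiv.addRight y).measurableEmbedding u {x | x - y ∈ cell}
    rw [← h, μT]
    congr 2
    ext x
    simp
  rw [h1, μT]
  refine (isAddFundamentalDomain_add_cell y).setIntegral_eq isAddFundamentalDomain_cell
    fun g x => ?_
  change u ((g : E3) + x) = u x
  rw [add_comm, hu.add_lattice]

theorem SpacePeriodic.locallyIntegrable (hu : SpacePeriodic u) (h : Integrable u μT) :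
    LocallyIntegrable u volume := by
  intro y
  refine ⟨Metric.closedBall y 1, Metric.closedBall_mem_nhds y one_pos, ?_⟩
  have h1 : IntegrableOn u {x | x - y ∈ cell} volume := by
    rw [(isAddFundamentalDomain_add_cell y).integrableOn_iff isAddFundamentalDomain_cell]
    · exact h
    · intro g x
      change u ((g : E3) + x) = u x
      rw [add_comm, hu.add_lattice]
  refine h1.mono_set fun x hx => ball_subset_cell ?_
  rwa [mem_closedBall_zero_iff, ← dist_eq_norm]

theorem SpacePeriodic.bounded_of_continuous (hu : SpacePeriodic u) (hc : Continuous u) :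
    ∃ C, 0 ≤ C ∧ ∀ x, ‖u x‖ ≤ C := by
  obtain ⟨C, hC⟩ := (isCompact_closedBall (0 : E3) (3 * Real.pi)).exists_bound_of_continuousOn
    hc.continuousOn
  refine ⟨max C 0, le_max_right _ _, fun x => ?_⟩
  rw [← hu.comp_wrap x]
  exact (hC _ (cell_subset_closedBall (wrap_mem_cell x))).trans (le_max_left _ _)

theorem SpacePeriodic.memLp_of_continuous (hu : SpacePeriodic u) (hc : Continuous u)
    (p : ℝ≥0∞) : MemLp u p μT := by
  obtain ⟨C, -, hC⟩ := hu.bounded_of_continuous hc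
  refine MemLp.of_bound ?_ C (Eventually.of_forall hC)
  exact hc.aestronglyMeasurable

theorem SpacePeriodic.integrable_of_continuous (hu : SpacePeriodic u) (hc : Continuous u) :
    Integrable u μT :=
  memLp_one_iff_integrable.1 (hu.memLp_of_continuous hc 1)

/-- A continuous function on `𝕋³ × ℝ³` which vanishes for large values of the second variable is
integrable. -/
theorem integrable_prod_of_continuous {H : E3 × E3 → F} (hH : Continuous H)
    (h0 : ∀ x y, 1 < ‖y‖ → H (x, y) = 0) : Integrable H (μT.prod volume) := by
  set K : Set (E3 × E3) := Metric.closedBall (0 : E3) (3 * Real.pi) ×ˢ Metric.closedBall (0 : E3) 1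
  have hK : IsCompact K := (isCompact_closedBall _ _).prod (isCompact_closedBall _ _)
  have h1 : IntegrableOn H K (volume.prod volume) := hH.continuousOn.integrableOn_compact hK
  have h2 : IntegrableOn H (cell ×ˢ univ) (volume.prod volume) := by
    refine IntegrableOn.of_forall_sdiff_eq_zero h1 (measurableSet_cell.prod MeasurableSet.univ)
      fun p hp => ?_
    refine h0 p.1 p.2 (not_le.1 fun hle => hp.2 ⟨cell_subset_closedBall hp.1.1, ?_⟩)
    simpa using hle
  rw [IntegrableOn, ← Measure.prod_restrict, Measure.restrict_univ] at h2
  exact h2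

end Periodic

/-! ### Mollification -/

/-- A smooth convolution kernel supported in the closed unit ball. The unit ball lies in the period
cell, so that convolving a periodic function with such a kernel involves only one period. -/
structure IsKernel (k : E3 → ℝ) : Prop where
  smooth : ContDiff ℝ ∞ k
  eq_zero : ∀ y, 1 < ‖y‖ → k y = 0

/-- The average `x ↦ ∫ k(y) u(x + y) dy`. For an even kernel `k` this is the convolution of `k`
and `u`. -/
def mollify {F : Type*} [NormedAddCommGroup F] [NormedSpace ℝ F] (k : E3 → ℝ) (u : E3 → F)
    (x : E3) : F :=
  ∫ y, k y • u (x + y)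

theorem fderiv_eq_zero_of_lt_norm {k : E3 → ℝ} {r : ℝ} (hk : ∀ y, r < ‖y‖ → k y = 0) {y : E3}
    (hy : r < ‖y‖) : fderiv ℝ k y = 0 := by
  have h : k =ᶠ[𝓝 y] fun _ => 0 := by
    filter_upwards [(isOpen_lt continuous_const continuous_norm).mem_nhds hy] with z hz
    exact hk z hz
  rw [h.fderiv_eq]
  simp

theorem fderiv_comp_neg {F : Type*} [NormedAddCommGroup F] [NormedSpace ℝ F] {g : E3 → F}
    (hg : Differentiable ℝ g) (y : E3) : fderiv ℝ (fun y => g (-y)) (-y) = -fderiv ℝ g y := by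
  have h1 : HasFDerivAt g (fderiv ℝ g y) (- -y) := by
    rw [neg_neg]
    exact (hg y).hasFDerivAt
  have h2 : -fderiv ℝ g y = (fderiv ℝ g y).comp (-ContinuousLinearMap.id ℝ E3) := by
    ext; simp
  rw [h2]
  exact (h1.comp (-y) (hasFDerivAt_id (-y)).neg).fderiv

namespace IsKernel

variable {k : E3 → ℝ}

theorem hasCompactSupport (hk : IsKernel k) : HasCompactSupport k := by
  refine HasCompactSupport.intro (isCompact_closedBall (0 : E3) 1) fun x hx => hk.eq_zero x ?_
  simpa using hx

theorem fderiv_eq_zero (hk : IsKernel k) {y : E3} (hy : 1 < ‖y‖) : fderiv ℝ k y = 0 :=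
  fderiv_eq_zero_of_lt_norm hk.eq_zero hy

theorem continuous_fderiv (hk : IsKernel k) : Continuous (fderiv ℝ k) :=
  hk.smooth.continuous_fderiv (by simp)

theorem fderiv_apply (hk : IsKernel k) (h : E3) : IsKernel fun y => fderiv ℝ k y h where
  smooth := (hk.smooth.fderiv_right (m := ∞) (by simp)).clm_apply contDiff_const
  eq_zero y hy := by simp [hk.fderiv_eq_zero hy]

theorem exists_bound (hk : IsKernel k) : ∃ C, 0 ≤ C ∧ ∀ y, ‖k y‖ ≤ C := by
  obtain ⟨C, hC⟩ := hk.hasCompactSupport.exists_bound_of_continuous hk.smooth.continuous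
  exact ⟨max C 0, le_max_right _ _, fun y => (hC y).trans (le_max_left _ _)⟩

theorem integrable (hk : IsKernel k) : Integrable k :=
  hk.smooth.continuous.integrable_of_hasCompactSupport hk.hasCompactSupport

end IsKernel

section Mollify

variable {F : Type*} [NormedAddCommGroup F] [NormedSpace ℝ F] {k : E3 → ℝ} {u : E3 → F}

theorem IsKernel.integrable_smul (hk : IsKernel k) (hu : SpacePeriodic u) (hi : Integrable u μT)
    (x : E3) : Integrable fun y => k y • u (x + y) := by
  have h : SpacePeriodic fun y => u (y + x) := hu.add_right x
  have hloc := h.locallyIntegrable (hu.integrable_add_right hi x)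
  have h2 := hloc.integrable_smul_left_of_hasCompactSupport hk.smooth.continuous
    hk.hasCompactSupport
  simpa only [add_comm] using h2

theorem norm_mollify_le (hk : IsKernel k) (hu : SpacePeriodic u) (hi : Integrable u μT) {C : ℝ}
    (hC : ∀ y, ‖k y‖ ≤ C) (x : E3) : ‖mollify k u x‖ ≤ C * ∫ z, ‖u z‖ ∂μT := by
  have hn : SpacePeriodic fun z => ‖u z‖ := fun x i => by simp only [hu x i]
  have h0 : ∀ y ∉ cell, ‖k y • u (x + y)‖ = 0 := fun y hy => by
    have : 1 < ‖y‖ := not_le.1 fun h => hy (ball_subset_cell (by simpa using h))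
    simp [hk.eq_zero y this]
  calc ‖mollify k u x‖ ≤ ∫ y, ‖k y • u (x + y)‖ := norm_integral_le_integral_norm _
    _ = ∫ y, ‖k y • u (x + y)‖ ∂μT := (setIntegral_eq_integral_of_forall_compl_eq_zero h0).symm
    _ ≤ ∫ y, C * ‖u (y + x)‖ ∂μT := by
      refine integral_mono (hk.integrable_smul hu hi x).norm.integrableOn
        ((hu.integrable_add_right hi x).norm.const_mul C) fun y => ?_
      simp only [norm_smul, add_comm y x]
      exact mul_le_mul_of_nonneg_right (hC y) (norm_nonneg _)
    _ = C * ∫ z, ‖u z‖ ∂μT := by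
      rw [integral_const_mul, hn.integral_add_right x]

theorem mollify_sub (hk : IsKernel k) {w : E3 → F} (hu : SpacePeriodic u) (hi : Integrable u μT)
    (hw : SpacePeriodic w) (hwi : Integrable w μT) (x : E3) :
    mollify k (fun z => u z - w z) x = mollify k u x - mollify k w x := by
  simp only [mollify, smul_sub]
  exact integral_sub (hk.integrable_smul hu hi x) (hk.integrable_smul hw hwi x)

theorem SpacePeriodic.mollify (hu : SpacePeriodic u) (k : E3 → ℝ) :
    SpacePeriodic (mollify k u) := by
  intro x i
  simp only [TorusNS.mollify]
  congr 1
  funext y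
  rw [add_right_comm, hu]

theorem mollify_eq_convolution (k : E3 → ℝ) (u : E3 → F) :
    mollify k u = convolution (fun y => k (-y)) u (ContinuousLinearMap.lsmul ℝ ℝ) volume := by
  funext x
  rw [convolution_def, mollify, ← integral_neg_eq_self]
  simp [sub_eq_add_neg]

theorem hasCompactSupport_comp_neg (hk : IsKernel k) : HasCompactSupport fun y => k (-y) :=
  hk.hasCompactSupport.comp_homeomorph (Homeomorph.neg E3)

theorem contDiff_mollify (hk : IsKernel k) (hu : SpacePeriodic u) (hi : Integrable u μT) :
    ContDiff ℝ ∞ (mollify k u) := by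
  rw [mollify_eq_convolution]
  exact (hasCompactSupport_comp_neg hk).contDiff_convolution_left _
    (hk.smooth.comp contDiff_neg) (hu.locallyIntegrable hi)

/-- The derivative falls on the kernel; the sign is that of an integration by parts, as
`mollify` shifts the argument by `+y`. -/
theorem fderiv_mollify [CompleteSpace F] (hk : IsKernel k) (hu : SpacePeriodic u)
    (hi : Integrable u μT) (x h : E3) :
    fderiv ℝ (mollify k u) x h = -mollify (fun y => fderiv ℝ k y h) u x := by
  have hk' : ContDiff ℝ 1 fun y => k (-y) := (hk.smooth.of_le (by simp)).comp contDiff_neg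
  have hd := (hasCompactSupport_comp_neg hk).hasFDerivAt_convolution_left
    (ContinuousLinearMap.lsmul ℝ ℝ : ℝ →L[ℝ] F →L[ℝ] F) hk' (hu.locallyIntegrable hi) x
  have hex := ((hasCompactSupport_comp_neg hk).fderiv ℝ).convolutionExists_left
    ((ContinuousLinearMap.lsmul ℝ ℝ : ℝ →L[ℝ] F →L[ℝ] F).precompL E3)
    (hk'.continuous_fderiv one_ne_zero) (hu.locallyIntegrable hi) x
  rw [mollify_eq_convolution, hd.fderiv, convolution_def, ContinuousLinearMap.integral_apply hex,
    mollify, ← integral_neg, ← integral_neg_eq_self]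
  refine integral_congr_ae (Eventually.of_forall fun y => ?_)
  have hy := fderiv_comp_neg (hk.smooth.differentiable (by simp)) y
  simp [ContinuousLinearMap.precompL_apply, hy]

/-- For a smooth function the derivative falls on the function itself. -/
theorem fderiv_mollify_of_contDiff [CompleteSpace F] (hk : IsKernel k) (hu : SpacePeriodic u)
    (hc : ContDiff ℝ ∞ u) (x h : E3) :
    fderiv ℝ (mollify k u) x h = mollify k (fun z => fderiv ℝ u z h) x := by
  have hc' : Continuous (fderiv ℝ u) := hc.continuous_fderiv (by simp)
  have hfd : ∀ y, fderiv ℝ (fun y => u (x + y)) y = fderiv ℝ u (x + y) := fun y =>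
    fderiv_comp_add_left x
  have hint : ∀ {g : E3 → F}, Continuous g → ∀ {l : E3 → ℝ}, IsKernel l →
      Integrable fun y => l y • g y := fun hg l hl =>
    (hl.smooth.continuous.smul hg).integrable_of_hasCompactSupport
      hl.hasCompactSupport.smul_right
  have hux : Continuous fun y => u (x + y) := hc.continuous.comp (continuous_const.add continuous_id)
  have key := integral_smul_fderiv_eq_neg_fderiv_smul_of_integrable (μ := (volume : Measure E3))
    (f := k) (g := fun y => u (x + y)) (v := h) (hint hux (hk.fderiv_apply h))
    (by
      refine hint ?_ hk
      simp only [hfd]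
      exact (hc'.comp (continuous_const.add continuous_id)).clm_apply continuous_const)
    (hint hux hk)
    (fun _ _ => (hk.smooth.differentiable (by simp)).differentiableAt)
    (fun y _ => ((hc.differentiable (by simp)).differentiableAt).comp y
      ((differentiableAt_const x).add differentiableAt_id))
  rw [fderiv_mollify hk hu (hu.integrable_of_continuous hc.continuous), mollify, mollify, ← key]
  simp only [hfd]

/-- Mollification turns `L¹` convergence into pointwise convergence. -/
theorem tendsto_mollify (hk : IsKernel k) (hu : SpacePeriodic u) (hi : Integrable u μT)
    {w : ℕ → E3 → F} (hw : ∀ n, SpacePeriodic (w n)) (hwi : ∀ n, Integrable (w n) μT)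
    (hlim : Tendsto (fun n => ∫ z, ‖u z - w n z‖ ∂μT) atTop (𝓝 0)) (x : E3) :
    Tendsto (fun n => mollify k (w n) x) atTop (𝓝 (mollify k u x)) := by
  obtain ⟨C, -, hC⟩ := hk.exists_bound
  rw [tendsto_iff_norm_sub_tendsto_zero]
  refine squeeze_zero (fun _ => norm_nonneg _) (fun n => ?_) (by simpa using hlim.const_mul C)
  rw [norm_sub_rev, ← mollify_sub hk hu hi (hw n) (hwi n)]
  exact norm_mollify_le hk (fun x i => congrArg₂ (· - ·) (hu x i) (hw n x i)) (hi.sub (hwi n)) hC x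

end Mollify

/-! ### Solenoidal fields -/

theorem integral_norm_le_eLpNorm {F : Type*} [NormedAddCommGroup F] {f : E3 → F}
    (hf : MemLp f 2 μT) :
    ∫ x, ‖f x‖ ∂μT ≤ (eLpNorm f 2 μT).toReal * (μT univ ^ (1 / 2 : ℝ)).toReal := by
  rw [← ENNReal.toReal_mul, integral_norm_eq_lintegral_enorm hf.1]
  have h := eLpNorm_le_eLpNorm_mul_rpow_measure_univ (p := 1) (q := 2) (by norm_num) hf.1
  have h' : (1 / (1 : ℝ≥0∞).toReal - 1 / (2 : ℝ≥0∞).toReal) = (1 / 2 : ℝ) := by norm_num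
  rw [eLpNorm_one_eq_lintegral_enorm, h'] at h
  refine ENNReal.toReal_mono (ENNReal.mul_ne_top hf.2.ne ?_) h
  exact ENNReal.rpow_ne_top_of_nonneg (by norm_num) (measure_ne_top _ _)

theorem tendsto_integral_norm_of_eLpNorm_le {F : Type*} [NormedAddCommGroup F] {f : ℕ → E3 → F}
    (hf : ∀ n, MemLp (f n) 2 μT)
    (hle : ∀ n : ℕ, eLpNorm (f n) 2 μT ≤ ENNReal.ofReal (1 / ((n : ℝ) + 1))) :
    Tendsto (fun n => ∫ x, ‖f n x‖ ∂μT) atTop (𝓝 0) := by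
  have h0 := tendsto_one_div_add_atTop_nhds_zero_nat (𝕜 := ℝ).mul_const
    (μT univ ^ (1 / 2 : ℝ)).toReal
  rw [zero_mul] at h0
  refine squeeze_zero (fun _ => integral_nonneg fun _ => norm_nonneg _) (fun n => ?_) h0
  refine (integral_norm_le_eLpNorm (hf n)).trans ?_
  gcongr
  refine (ENNReal.toReal_mono ENNReal.ofReal_ne_top (hle n)).trans ?_
  rw [ENNReal.toReal_ofReal (by positivity)]

theorem SpacePeriodic.fderiv {F : Type*} [NormedAddCommGroup F] [NormedSpace ℝ F] {w : E3 → F}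
    (hw : SpacePeriodic w) : SpacePeriodic (fderiv ℝ w) := by
  intro x i
  have h : (fun y => w (y + (2 * Real.pi) • e i)) = w := funext fun y => hw y i
  rw [← fderiv_comp_add_right, h]

namespace SmoothSolenoidal

variable {w : E3 → E3}

theorem memLp (hw : SmoothSolenoidal w) : MemLp w 2 μT :=
  hw.periodic.memLp_of_continuous hw.smooth.continuous 2

theorem integrable (hw : SmoothSolenoidal w) : Integrable w μT :=
  hw.periodic.integrable_of_continuous hw.smooth.continuous

theorem continuous_fderiv (hw : SmoothSolenoidal w) : Continuous (fderiv ℝ w) :=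
  hw.smooth.continuous_fderiv (by simp)

theorem memLp_fderiv (hw : SmoothSolenoidal w) : MemLp (fderiv ℝ w) 2 μT :=
  hw.periodic.fderiv.memLp_of_continuous hw.continuous_fderiv 2

end SmoothSolenoidal

/-- The vector field `u` is the limit in `L¹(𝕋³)` of the smooth solenoidal fields `w n`. -/
structure IsSolenoidalLimit (u : E3 → E3) (w : ℕ → E3 → E3) : Prop where
  periodic : SpacePeriodic u
  integrable : Integrable u μT
  solenoidal : ∀ n, SmoothSolenoidal (w n)
  tendsto : Tendsto (fun n => ∫ x, ‖u x - w n x‖ ∂μT) atTop (𝓝 0)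

theorem MemH.integrable {u : E3 → E3} (hu : MemH u) : Integrable u μT :=
  hu.memLp.integrable (by norm_num)

theorem MemH.exists_limit {u : E3 → E3} (hu : MemH u) : ∃ w, IsSolenoidalLimit u w := by
  choose w hw hle using fun n : ℕ => hu.approx (ENNReal.ofReal (1 / ((n : ℝ) + 1)))
    (ENNReal.ofReal_pos.2 (by positivity))
  exact ⟨w, hu.periodic, hu.integrable, hw,
    tendsto_integral_norm_of_eLpNorm_le (fun n => hu.memLp.sub (hw n).memLp) hle⟩

theorem MemV.exists_limit {u : E3 → E3} {A : E3 → E3 →L[ℝ] E3} (hu : MemV u A) :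
    ∃ w, IsSolenoidalLimit u w ∧
      Tendsto (fun n => ∫ x, ‖A x - fderiv ℝ (w n) x‖ ∂μT) atTop (𝓝 0) := by
  choose w hw hle hle' using fun n : ℕ => hu.approx (ENNReal.ofReal (1 / ((n : ℝ) + 1)))
    (ENNReal.ofReal_pos.2 (by positivity))
  exact ⟨w, ⟨hu.periodic, hu.memLp.integrable (by norm_num), hw,
    tendsto_integral_norm_of_eLpNorm_le (fun n => hu.memLp.sub (hw n).memLp) hle⟩,
    tendsto_integral_norm_of_eLpNorm_le (fun n => hu.memLp_grad.sub (hw n).memLp_fderiv) hle'⟩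

theorem norm_e (j : Fin 3) : ‖e j‖ = 1 := by simp [e]

theorem sum_smul_e (h : E3) : ∑ j, h j • e j = h := by
  ext i
  simp only [e, Fin.sum_univ_three]
  fin_cases i <;> simp

theorem clm_eq_sum {F : Type*} [NormedAddCommGroup F] [NormedSpace ℝ F] (L : E3 →L[ℝ] F) (h : E3) :
    L h = ∑ j, h j • L (e j) := by
  conv_lhs => rw [← sum_smul_e h]
  simp

variable {k : E3 → ℝ} {u : E3 → E3}

/-- The mollification of a solenoidal field is solenoidal. -/
theorem IsSolenoidalLimit.divergence_mollify {w : ℕ → E3 → E3} (hu : IsSolenoidalLimit u w)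
    (hk : IsKernel k) (x : E3) : divergence (mollify k u) x = 0 := by
  have hlim : Tendsto (fun n => divergence (mollify k (w n)) x) atTop
      (𝓝 (divergence (mollify k u) x)) := by
    simp only [divergence, fderiv_mollify hk hu.periodic hu.integrable,
      fun n => fderiv_mollify hk (hu.solenoidal n).periodic (hu.solenoidal n).integrable]
    refine tendsto_finsetSum _ fun j _ => ?_
    have h := (tendsto_mollify (hk.fderiv_apply (e j)) hu.periodic hu.integrable
      (fun n => (hu.solenoidal n).periodic) (fun n => (hu.solenoidal n).integrable) hu.tendsto x).neg
    exact ((EuclideanSpace.proj (𝕜 := ℝ) j).continuous.tendsto _).comp h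
  have hz : ∀ n, divergence (mollify k (w n)) x = 0 := fun n => by
    have hw := hu.solenoidal n
    simp only [divergence, fderiv_mollify_of_contDiff hk hw.periodic hw.smooth]
    have hper : ∀ j, SpacePeriodic fun z => fderiv ℝ (w n) z (e j) := fun j x i => by
      simp only [hw.periodic.fderiv x i]
    have hcont : ∀ j, Continuous fun z => fderiv ℝ (w n) z (e j) := fun j =>
      hw.continuous_fderiv.clm_apply continuous_const
    have hint : ∀ j, Integrable fun y => k y • fderiv ℝ (w n) (x + y) (e j) := fun j =>
      hk.integrable_smul (hper j) ((hper j).integrable_of_continuous (hcont j)) x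
    have h1 : ∀ j, (mollify k (fun z => fderiv ℝ (w n) z (e j)) x) j =
        ∫ y, k y * (fderiv ℝ (w n) (x + y) (e j)) j := fun j => by
      have := (EuclideanSpace.proj (𝕜 := ℝ) j).integral_comp_comm (hint j)
      simpa [mollify] using this.symm
    simp only [h1]
    rw [← integral_finsetSum _ fun j _ => by
      simpa using (EuclideanSpace.proj (𝕜 := ℝ) j).integrable_comp (hint j)]
    have h2 : ∀ y, ∑ j, k y * (fderiv ℝ (w n) (x + y) (e j)) j = 0 := fun y => by
      have h3 := hw.div_free (x + y)
      rw [divergence] at h3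
      rw [← Finset.mul_sum, h3, mul_zero]
    simp only [h2, integral_zero]
  simp only [hz] at hlim
  exact (tendsto_nhds_unique hlim tendsto_const_nhds)

/-- Mollification commutes with the weak gradient. -/
theorem MemV.fderiv_mollify {A : E3 → E3 →L[ℝ] E3} (hu : MemV u A) (hk : IsKernel k) (x : E3)
    (j : Fin 3) : fderiv ℝ (mollify k u) x (e j) = mollify k (fun z => A z (e j)) x := by
  obtain ⟨w, hw, hlim⟩ := hu.exists_limit
  have hAi : Integrable A μT := hu.memLp_grad.integrable (by norm_num)
  have hDi : ∀ n, Integrable (fderiv ℝ (w n)) μT := fun n =>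
    (hw.solenoidal n).memLp_fderiv.integrable (by norm_num)
  have h1 : Tendsto (fun n => fderiv ℝ (mollify k (w n)) x (e j)) atTop
      (𝓝 (fderiv ℝ (mollify k u) x (e j))) := by
    simp only [TorusNS.fderiv_mollify hk hw.periodic hw.integrable,
      fun n => TorusNS.fderiv_mollify hk (hw.solenoidal n).periodic (hw.solenoidal n).integrable]
    exact (tendsto_mollify (hk.fderiv_apply (e j)) hw.periodic hw.integrable
      (fun n => (hw.solenoidal n).periodic) (fun n => (hw.solenoidal n).integrable) hw.tendsto x).neg
  have h2 : Tendsto (fun n => fderiv ℝ (mollify k (w n)) x (e j)) atTop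
      (𝓝 (mollify k (fun z => A z (e j)) x)) := by
    simp only [fun n => fderiv_mollify_of_contDiff hk (hw.solenoidal n).periodic
      (hw.solenoidal n).smooth]
    refine tendsto_mollify hk (fun x i => by simp only [hu.periodic_grad x i])
      (hAi.apply_continuousLinearMap _)
      (fun n x i => by simp only [(hw.solenoidal n).periodic.fderiv x i])
      (fun n => (hDi n).apply_continuousLinearMap _) ?_ x
    refine squeeze_zero (fun _ => integral_nonneg fun _ => norm_nonneg _) (fun n => ?_) hlim
    refine integral_mono (((hAi.sub (hDi n)).apply_continuousLinearMap (e j)).norm)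
      (hAi.sub (hDi n)).norm fun z => ?_
    have := (A z - fderiv ℝ (w n) z).le_opNorm (e j)
    simpa [norm_e] using this
  exact tendsto_nhds_unique h1 h2

/-! ### Correlations and translation differences -/

section Correlation

variable {k : E3 → ℝ} {u w : E3 → E3}

theorem aestronglyMeasurable_prod_add {F : Type*} [NormedAddCommGroup F] {G : E3 → F}
    (hG : SpacePeriodic G) (hm : AEStronglyMeasurable G μT) :
    AEStronglyMeasurable (fun p : E3 × E3 => G (p.1 + p.2)) (μT.prod volume) := by
  have hac : μT.prod (volume : Measure E3) ≪ (volume : Measure E3).prod volume :=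
    Measure.absolutelyContinuous_of_le Measure.restrict_le_self |>.prod
      Measure.AbsolutelyContinuous.rfl
  have hqmp : Measure.QuasiMeasurePreserving (fun p : E3 × E3 => p.1 + p.2)
      ((volume : Measure E3).prod volume) volume :=
    Measure.quasiMeasurePreserving_snd.comp
      (measurePreserving_prod_add (volume : Measure E3) volume).quasiMeasurePreserving
  exact ((hG.aestronglyMeasurable hm).comp_quasiMeasurePreserving hqmp).mono_ac hac

theorem integrable_prod_mul {G : E3 → ℝ} (hk : Integrable k) (hG : SpacePeriodic G)
    (hi : Integrable G μT) :
    Integrable (fun p : E3 × E3 => k p.2 * G (p.1 + p.2)) (μT.prod volume) := by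
  have hm : AEStronglyMeasurable (fun p : E3 × E3 => k p.2 * G (p.1 + p.2))
      (μT.prod volume) :=
    hk.aestronglyMeasurable.comp_snd.mul (aestronglyMeasurable_prod_add hG hi.1)
  rw [integrable_prod_iff' hm]
  refine ⟨Eventually.of_forall fun y => (hG.integrable_add_right hi y).const_mul (k y), ?_⟩
  have h : ∀ y, ∫ x, ‖k y * G (x + y)‖ ∂μT = ‖k y‖ * ∫ x, ‖G x‖ ∂μT := fun y => by
    have hn : SpacePeriodic fun z => ‖G z‖ := fun x i => by simp only [hG x i]
    simp only [norm_mul, integral_const_mul]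
    rw [hn.integral_add_right y]
  simp only [h]
  exact hk.norm.mul_const _

theorem integrable_norm_sq {F : Type*} [NormedAddCommGroup F] {f : E3 → F}
    (hf : MemLp f 2 μT) : Integrable (fun x => ‖f x‖ ^ 2) μT :=
  (memLp_two_iff_integrable_sq_norm hf.1).1 hf

theorem integrable_prod_inner (hk : Integrable k) (hu : MemLp u 2 μT) (hw : SpacePeriodic w)
    (hw2 : MemLp w 2 μT) :
    Integrable (fun p : E3 × E3 => k p.2 * inner ℝ (u p.1) (w (p.1 + p.2)))
      (μT.prod volume) := by
  have h1 : Integrable (fun p : E3 × E3 => ‖u p.1‖ ^ 2 * ‖k p.2‖) (μT.prod volume) :=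
    (integrable_norm_sq hu).mul_prod hk.norm
  have h2 : Integrable (fun p : E3 × E3 => ‖k p.2‖ * ‖w (p.1 + p.2)‖ ^ 2) (μT.prod volume) :=
    integrable_prod_mul (G := fun z => ‖w z‖ ^ 2) hk.norm (fun x i => by simp only [hw x i])
      (integrable_norm_sq hw2)
  refine (h1.add h2).mono' (hk.aestronglyMeasurable.comp_snd.mul
    (hu.1.comp_fst.inner (aestronglyMeasurable_prod_add hw hw2.1)))
    (Eventually.of_forall fun p => ?_)
  rw [norm_mul, Pi.add_apply]
  have h3 := norm_inner_le_norm (𝕜 := ℝ) (u p.1) (w (p.1 + p.2))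
  have h4 : ‖inner ℝ (u p.1) (w (p.1 + p.2))‖ ≤ ‖u p.1‖ ^ 2 + ‖w (p.1 + p.2)‖ ^ 2 := by
    nlinarith [sq_nonneg (‖u p.1‖ - ‖w (p.1 + p.2)‖), sq_nonneg (‖u p.1‖ + ‖w (p.1 + p.2)‖)]
  nlinarith [mul_le_mul_of_nonneg_left h4 (norm_nonneg (k p.2))]

/-- Mollification averages the correlations `(u, w(· + y))`. -/
theorem scal_mollify (hk : IsKernel k) (hu : MemLp u 2 μT) (hw : SpacePeriodic w)
    (hw2 : MemLp w 2 μT) :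
    scal u (mollify k w) = ∫ y, k y * scal u (fun x => w (x + y)) := by
  have h := integral_integral_swap
    (f := fun x y => k y * inner ℝ (u x) (w (x + y)))
    (integrable_prod_inner hk.integrable hu hw hw2)
  have h1 : ∀ x, inner ℝ (u x) (mollify k w x) = ∫ y, k y * inner ℝ (u x) (w (x + y)) :=
    fun x => by
      rw [mollify, ← integral_inner (hk.integrable_smul hw (hw2.integrable (by norm_num)) x)]
      simp only [inner_smul_right]
  simp only [scal, h1, h, integral_const_mul]

theorem integrable_mul_scal (hk : Integrable k) (hu : MemLp u 2 μT) (hw : SpacePeriodic w)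
    (hw2 : MemLp w 2 μT) : Integrable fun y => k y * scal u (fun x => w (x + y)) := by
  simpa only [scal, integral_const_mul] using
    (integrable_prod_inner hk hu hw hw2).integral_prod_right

theorem scal_add_right (hu : SpacePeriodic u) (hw : SpacePeriodic w) (y : E3) :
    scal u (fun x => w (x + y)) = scal w (fun x => u (x + -y)) := by
  have h : SpacePeriodic fun x => inner ℝ (u (x + -y)) (w x) := fun x i => by
    simp only [(hu.add_right (-y)) x i, hw x i]
  have := h.integral_add_right y
  simp only [scal, real_inner_comm, add_neg_cancel_right] at this ⊢
  exact this

/-- Mollification with an even kernel is a symmetric operator. -/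
theorem scal_mollify_comm (hk : IsKernel k) (heven : ∀ y, k (-y) = k y) (hu : SpacePeriodic u)
    (hu2 : MemLp u 2 μT) (hw : SpacePeriodic w) (hw2 : MemLp w 2 μT) :
    scal u (mollify k w) = scal w (mollify k u) := by
  rw [scal_mollify hk hu2 hw hw2, scal_mollify hk hw2 hu hu2, ← integral_neg_eq_self]
  simp only [heven, scal_add_right hu hw, neg_neg]

theorem normSq_nonneg (u : E3 → E3) : 0 ≤ normSq u := integral_nonneg fun _ => by positivity

theorem scal_self (u : E3 → E3) : scal u u = normSq u := by
  simp only [scal, normSq, real_inner_self_eq_norm_sq]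

theorem integrable_inner (hu : MemLp u 2 μT) (hw : MemLp w 2 μT) :
    Integrable (fun x => inner ℝ (u x) (w x)) μT := by
  refine ((integrable_norm_sq hu).add (integrable_norm_sq hw)).mono'
    (hu.1.inner hw.1) (Eventually.of_forall fun x => ?_)
  have h3 := norm_inner_le_norm (𝕜 := ℝ) (u x) (w x)
  simp only [Pi.add_apply]
  nlinarith [sq_nonneg (‖u x‖ - ‖w x‖), sq_nonneg (‖u x‖ + ‖w x‖)]

theorem normSq_add_right (hu : SpacePeriodic u) (y : E3) :
    normSq (fun x => u (x + y)) = normSq u := by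
  have h : SpacePeriodic fun x => ‖u x‖ ^ 2 := fun x i => by simp only [hu x i]
  exact h.integral_add_right y

theorem integral_add_sub_two_mul {X : Type*} [MeasurableSpace X] {μ : Measure X} {f g h : X → ℝ}
    (hf : Integrable f μ) (hg : Integrable g μ) (hh : Integrable h μ) :
    ∫ x, (f x + g x - 2 * h x) ∂μ = ∫ x, f x ∂μ + ∫ x, g x ∂μ - 2 * ∫ x, h x ∂μ := by
  have h1 := integral_add hf hg
  have h2 := integral_sub (hf.add hg) (hh.const_mul 2)
  simp only [Pi.add_apply, integral_const_mul] at h1 h2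
  rw [h2, h1]

theorem normSq_sub (hu : MemLp u 2 μT) (hw : MemLp w 2 μT) :
    normSq (fun x => w x - u x) = normSq w + normSq u - 2 * scal u w := by
  have h1 := integrable_norm_sq hu
  have h2 := integrable_norm_sq hw
  have h3 := integrable_inner hu hw
  have h : ∀ x, ‖w x - u x‖ ^ 2 = ‖w x‖ ^ 2 + ‖u x‖ ^ 2 - 2 * inner ℝ (u x) (w x) := fun x => by
    rw [norm_sub_sq_real, real_inner_comm]; ring
  simp only [normSq, scal, h]
  exact integral_add_sub_two_mul h2 h1 h3

/-- The Cauchy–Schwarz inequality in `L²(𝕋³)`. -/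
theorem sq_scal_le {u w : E3 → E3} (hu : MemLp u 2 μT) (hw : MemLp w 2 μT) :
    scal u w ^ 2 ≤ normSq u * normSq w := by
  have h : ∀ x : ℝ, 0 ≤ normSq u * (x * x) + (-2 * scal u w) * x + normSq w := fun x => by
    have h1 := normSq_sub (hu.const_smul x) hw
    have h2 : normSq (x • u) = x ^ 2 * normSq u := by
      simp only [normSq, Pi.smul_apply, norm_smul, mul_pow, Real.norm_eq_abs, sq_abs,
        integral_const_mul]
    have h3 : scal (x • u) w = x * scal u w := by
      simp only [scal, Pi.smul_apply, real_inner_smul_left, integral_const_mul]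
    have h4 := normSq_nonneg fun z => w z - (x • u) z
    rw [h1, h2, h3] at h4
    linarith
  have hd := discrim_le_zero h
  rw [discrim] at hd
  linarith

/-- The square of the `L²` norm of the translation difference `u(· + y) - u`. -/
def shiftSq (u : E3 → E3) (y : E3) : ℝ := normSq fun x => u (x + y) - u x

theorem shiftSq_nonneg (u : E3 → E3) (y : E3) : 0 ≤ shiftSq u y := normSq_nonneg _

theorem shiftSq_eq (hu : SpacePeriodic u) (hu2 : MemLp u 2 μT) (y : E3) :
    shiftSq u y = 2 * normSq u - 2 * scal u (fun x => u (x + y)) := by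
  rw [shiftSq, normSq_sub hu2 (hu.memLp_add_right hu2 y), normSq_add_right hu]
  ring

theorem shiftSq_le (hu : SpacePeriodic u) (hu2 : MemLp u 2 μT) (y : E3) :
    shiftSq u y ≤ 4 * normSq u := by
  have h := normSq_add_right hu y
  have h2 : normSq (fun x => u (x + y) - -u x) =
      normSq (fun x => u (x + y)) + normSq (fun x => -u x) - 2 * scal (fun x => -u x)
        (fun x => u (x + y)) := normSq_sub hu2.neg (hu.memLp_add_right hu2 y)
  have h3 : normSq (fun x => -u x) = normSq u := by simp [normSq]
  have h4 : scal (fun x => -u x) (fun x => u (x + y)) = -scal u (fun x => u (x + y)) := by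
    simp [scal, integral_neg]
  have h5 := normSq_nonneg (fun x => u (x + y) - -u x)
  rw [shiftSq_eq hu hu2]
  rw [h2, h3, h4, h] at h5
  linarith

theorem integrable_mul_shiftSq (hk : Integrable k) (hu : SpacePeriodic u) (hu2 : MemLp u 2 μT) :
    Integrable fun y => k y * shiftSq u y := by
  have h := (hk.mul_const (2 * normSq u)).sub ((integrable_mul_scal hk hu2 hu hu2).const_mul 2)
  refine h.congr (Eventually.of_forall fun y => ?_)
  simp only [Pi.sub_apply, shiftSq_eq hu hu2]
  ring

/-- For a kernel of total mass one, the deficit `(u, u) - (u, k * u)` is a mean of the translation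
differences. -/
theorem scal_mollify_self (hk : IsKernel k) (h1 : ∫ y, k y = 1) (hu : SpacePeriodic u)
    (hu2 : MemLp u 2 μT) :
    scal u (mollify k u) = normSq u - (1 / 2) * ∫ y, k y * shiftSq u y := by
  have h : ∀ y, k y * shiftSq u y =
      k y * (2 * normSq u) - 2 * (k y * scal u (fun x => u (x + y))) := fun y => by
    rw [shiftSq_eq hu hu2]; ring
  simp only [h]
  rw [integral_sub (hk.integrable.mul_const _)
    ((integrable_mul_scal hk.integrable hu2 hu hu2).const_mul 2), integral_mul_const, h1,
    integral_const_mul, ← scal_mollify hk hu2 hu hu2]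
  ring

theorem eLpNorm_two_eq {F : Type*} [NormedAddCommGroup F] {f : E3 → F} (hf : MemLp f 2 μT) :
    eLpNorm f 2 μT = ENNReal.ofReal √(∫ x, ‖f x‖ ^ 2 ∂μT) := by
  rw [hf.eLpNorm_eq_integral_rpow_norm (by norm_num) (by norm_num), Real.sqrt_eq_rpow]
  norm_num

theorem shiftSq_eq_eLpNorm (hu : SpacePeriodic u) (hu2 : MemLp u 2 μT) (y : E3) :
    shiftSq u y = (eLpNorm (fun x => u (x + y) - u x) 2 μT).toReal ^ 2 := by
  have h : MemLp (fun x => u (x + y) - u x) 2 μT := (hu.memLp_add_right hu2 y).sub hu2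
  rw [eLpNorm_two_eq h,
    ENNReal.toReal_ofReal (Real.sqrt_nonneg _), Real.sq_sqrt (integral_nonneg fun _ => by positivity)]
  rfl

theorem sq_intervalIntegral_le {h : ℝ → ℝ} (hc : Continuous h) :
    (∫ s in (0 : ℝ)..1, h s) ^ 2 ≤ ∫ s in (0 : ℝ)..1, h s ^ 2 := by
  set m := ∫ s in (0 : ℝ)..1, h s with hm
  have h0 : 0 ≤ ∫ s in (0 : ℝ)..1, (h s - m) ^ 2 :=
    intervalIntegral.integral_nonneg zero_le_one fun _ _ => sq_nonneg _
  have h1 : ∀ s, (h s - m) ^ 2 = h s ^ 2 - 2 * m * h s + m ^ 2 := fun s => by ring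
  simp only [h1] at h0
  rw [intervalIntegral.integral_add, intervalIntegral.integral_sub,
    intervalIntegral.integral_const_mul, ← hm] at h0
  · simp only [intervalIntegral.integral_const, sub_zero, one_smul] at h0
    nlinarith
  all_goals exact Continuous.intervalIntegrable (by fun_prop) _ _

/-- The fundamental theorem of calculus along the segments from `x` to `x + y`, and Fubini. -/
theorem shiftSq_le_of_contDiff (hw : SpacePeriodic w) (hc : ContDiff ℝ ∞ w) (y : E3) :
    shiftSq w y ≤ ‖y‖ ^ 2 * ∫ x, ‖fderiv ℝ w x‖ ^ 2 ∂μT := by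
  have hDc : Continuous (fderiv ℝ w) := hc.continuous_fderiv (by simp)
  have hd : Differentiable ℝ w := hc.differentiable (by simp)
  obtain ⟨C, hC0, hC⟩ := hw.fderiv.bounded_of_continuous hDc
  have hpt : ∀ x, ‖w (x + y) - w x‖ ^ 2 ≤
      ‖y‖ ^ 2 * ∫ s in (0 : ℝ)..1, ‖fderiv ℝ w (x + s • y)‖ ^ 2 := fun x => by
    have hcont : Continuous fun s : ℝ => fderiv ℝ w (x + s • y) := hDc.comp (by fun_prop)
    have hftc : ∫ s in (0 : ℝ)..1, fderiv ℝ w (x + s • y) y = w (x + y) - w x := by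
      rw [intervalIntegral.integral_eq_sub_of_hasDerivAt (f := fun s => w (x + s • y))]
      · simp
      · intro s _
        have h2 : HasDerivAt (fun s : ℝ => x + s • y) y s := by
          simpa using ((hasDerivAt_id s).smul_const y).const_add x
        exact (hd (x + s • y)).hasFDerivAt.comp_hasDerivAt s h2
      · exact (hcont.clm_apply continuous_const).intervalIntegrable _ _
    have h3 : ‖w (x + y) - w x‖ ≤ ‖y‖ * ∫ s in (0 : ℝ)..1, ‖fderiv ℝ w (x + s • y)‖ := by
      rw [← hftc, ← intervalIntegral.integral_const_mul]
      refine (intervalIntegral.norm_integral_le_integral_norm zero_le_one).trans ?_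
      refine intervalIntegral.integral_mono_on zero_le_one
        ((hcont.clm_apply continuous_const).norm.intervalIntegrable _ _)
        ((continuous_const.mul hcont.norm).intervalIntegrable _ _) fun s _ => ?_
      rw [mul_comm]
      exact ContinuousLinearMap.le_opNorm _ _
    calc ‖w (x + y) - w x‖ ^ 2
        ≤ (‖y‖ * ∫ s in (0 : ℝ)..1, ‖fderiv ℝ w (x + s • y)‖) ^ 2 := by gcongr
      _ ≤ _ := by
        rw [mul_pow]
        gcongr
        exact sq_intervalIntegral_le hcont.norm
  have hJc : Continuous fun p : E3 × ℝ => ‖fderiv ℝ w (p.1 + p.2 • y)‖ ^ 2 :=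
    (hDc.comp (by fun_prop)).norm.pow 2
  have hJi : Integrable (fun p : E3 × ℝ => ‖fderiv ℝ w (p.1 + p.2 • y)‖ ^ 2)
      (μT.prod (volume.restrict (Ioc (0 : ℝ) 1))) := by
    refine Integrable.of_bound hJc.aestronglyMeasurable (C ^ 2) (Eventually.of_forall fun p => ?_)
    rw [norm_pow, norm_norm]
    exact pow_le_pow_left₀ (norm_nonneg _) (hC _) 2
  have hswap := integral_integral_swap (f := fun x s => ‖fderiv ℝ w (x + s • y)‖ ^ 2) hJi
  have hper : SpacePeriodic fun x => ‖fderiv ℝ w x‖ ^ 2 := fun x i => by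
    simp only [hw.fderiv x i]
  have hin : ∀ s : ℝ, ∫ x, ‖fderiv ℝ w (x + s • y)‖ ^ 2 ∂μT = ∫ x, ‖fderiv ℝ w x‖ ^ 2 ∂μT :=
    fun s => hper.integral_add_right _
  simp only [hin, integral_const, Measure.real, Measure.restrict_apply_univ, Real.volume_Ioc,
    sub_zero, ENNReal.ofReal_one, ENNReal.toReal_one, one_smul] at hswap
  rw [← hswap, ← integral_const_mul]
  refine integral_mono (integrable_norm_sq (((hw.add_right y).memLp_of_continuous
    (hc.continuous.comp (by fun_prop)) 2).sub (hw.memLp_of_continuous hc.continuous 2)))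
    (hJi.integral_prod_left.const_mul _) fun x => ?_
  have := hpt x
  rwa [intervalIntegral.integral_of_le zero_le_one] at this

/-- The translation differences of `u` differ from those of an approximation of `u` by at most
twice the error. -/
theorem eLpNorm_shift_le (hu : SpacePeriodic u) (hu2 : MemLp u 2 μT) (hw : SpacePeriodic w)
    (hc : ContDiff ℝ ∞ w) (y : E3) :
    eLpNorm (fun x => u (x + y) - u x) 2 μT ≤ 2 * eLpNorm (fun x => u x - w x) 2 μT +
      ENNReal.ofReal ‖y‖ * eLpNorm (fderiv ℝ w) 2 μT := by
  have hw2 := hw.memLp_of_continuous hc.continuous 2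
  have hdw : eLpNorm (fun x => w (x + y) - w x) 2 μT ≤
      ENNReal.ofReal ‖y‖ * eLpNorm (fderiv ℝ w) 2 μT := by
    have h : MemLp (fun x => w (x + y) - w x) 2 μT := (hw.memLp_add_right hw2 y).sub hw2
    rw [eLpNorm_two_eq h,
      eLpNorm_two_eq (hw.fderiv.memLp_of_continuous (hc.continuous_fderiv (by simp)) 2),
      ← ENNReal.ofReal_mul (norm_nonneg _)]
    refine ENNReal.ofReal_le_ofReal ?_
    rw [Real.sqrt_le_left (by positivity), mul_pow,
      Real.sq_sqrt (integral_nonneg fun _ => by positivity)]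
    exact shiftSq_le_of_contDiff hw hc y
  have hd : MemLp (fun x => u x - w x) 2 μT := hu2.sub hw2
  have hdp : SpacePeriodic fun x => u x - w x := fun x i => by simp only [hu x i, hw x i]
  have hdy := hdp.memLp_add_right hd y
  have heq : (fun x => u (x + y) - u x) = ((fun x => u (x + y) - w (x + y)) -
      fun x => u x - w x) + fun x => w (x + y) - w x := by
    funext x
    simp only [Pi.add_apply, Pi.sub_apply]
    abel
  rw [heq]
  refine (eLpNorm_add_le (hdy.1.sub hd.1) ((hw.memLp_add_right hw2 y).1.sub hw2.1)
    (by norm_num)).trans (add_le_add ((eLpNorm_sub_le hdy.1 hd.1 (by norm_num)).trans ?_) hdw)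
  rw [hdp.eLpNorm_add_right hd.1, two_mul]

/-- The translation differences of a Sobolev field are controlled by its gradient. -/
theorem MemV.shiftSq_le {A : E3 → E3 →L[ℝ] E3} (hu : MemV u A) (y : E3) :
    shiftSq u y ≤ ‖y‖ ^ 2 * ∫ x, ‖A x‖ ^ 2 ∂μT := by
  have hle : eLpNorm (fun x => u (x + y) - u x) 2 μT ≤
      ENNReal.ofReal ‖y‖ * eLpNorm A 2 μT := by
    have hεle : ∀ ε : ℝ≥0∞, 0 < ε → eLpNorm (fun x => u (x + y) - u x) 2 μT ≤
        ENNReal.ofReal ‖y‖ * eLpNorm A 2 μT + (2 + ENNReal.ofReal ‖y‖) * ε := by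
      intro ε hε
      obtain ⟨w, hw, h1, h2⟩ := hu.approx ε hε
      have h3 : eLpNorm (fderiv ℝ w) 2 μT ≤ eLpNorm A 2 μT + ε := by
        have heq : fderiv ℝ w = A - fun x => A x - fderiv ℝ w x := by
          funext x
          simp
        rw [heq]
        exact (eLpNorm_sub_le hu.memLp_grad.1 (hu.memLp_grad.1.sub hw.memLp_fderiv.1)
          (by norm_num)).trans (add_le_add le_rfl h2)
      calc _ ≤ _ := eLpNorm_shift_le hu.periodic hu.memLp hw.periodic hw.smooth y
        _ ≤ 2 * ε + ENNReal.ofReal ‖y‖ * (eLpNorm A 2 μT + ε) := by gcongr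
        _ = _ := by ring
    have hlim : Tendsto (fun ε : ℝ≥0∞ => ENNReal.ofReal ‖y‖ * eLpNorm A 2 μT +
        (2 + ENNReal.ofReal ‖y‖) * ε) (𝓝[>] 0) (𝓝 (ENNReal.ofReal ‖y‖ * eLpNorm A 2 μT)) := by
      have h := ((ENNReal.continuous_const_mul (a := 2 + ENNReal.ofReal ‖y‖)
        (by finiteness)).tendsto 0).const_add (ENNReal.ofReal ‖y‖ * eLpNorm A 2 μT)
      simp only [mul_zero, add_zero] at h
      exact h.mono_left nhdsWithin_le_nhds
    exact ge_of_tendsto hlim (eventually_mem_nhdsWithin.mono fun ε hε => hεle ε hε)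
  have hfin : ENNReal.ofReal ‖y‖ * eLpNorm A 2 μT ≠ ⊤ :=
    ENNReal.mul_ne_top ENNReal.ofReal_ne_top hu.memLp_grad.2.ne
  rw [shiftSq_eq_eLpNorm hu.periodic hu.memLp]
  refine (pow_le_pow_left₀ ENNReal.toReal_nonneg (ENNReal.toReal_mono hfin hle) 2).trans_eq ?_
  rw [ENNReal.toReal_mul, mul_pow, ENNReal.toReal_ofReal (norm_nonneg _),
    eLpNorm_two_eq hu.memLp_grad, ENNReal.toReal_ofReal (Real.sqrt_nonneg _),
    Real.sq_sqrt (integral_nonneg fun _ => by positivity)]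

/-- `u` is a limit of smooth periodic fields in `L²(𝕋³)`. -/
def IsSmoothLimit (u : E3 → E3) : Prop :=
  ∀ ε : ℝ≥0∞, 0 < ε → ∃ w, SpacePeriodic w ∧ ContDiff ℝ ∞ w ∧
    eLpNorm (fun x => u x - w x) 2 μT ≤ ε

theorem MemH.isSmoothLimit (hu : MemH u) : IsSmoothLimit u := fun ε hε =>
  let ⟨w, hw, h⟩ := hu.approx ε hε
  ⟨w, hw.periodic, hw.smooth, h⟩

theorem MemV.isSmoothLimit_grad {A : E3 → E3 →L[ℝ] E3} (hu : MemV u A) (j : Fin 3) :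
    IsSmoothLimit fun x => A x (e j) := by
  intro ε hε
  obtain ⟨w, hw, -, h⟩ := hu.approx ε hε
  refine ⟨fun x => fderiv ℝ w x (e j), fun x i => by simp only [hw.periodic.fderiv x i],
    (hw.smooth.fderiv_right (m := ∞) (by simp)).clm_apply contDiff_const, le_trans ?_ h⟩
  refine eLpNorm_mono fun x => ?_
  have := (A x - fderiv ℝ w x).le_opNorm (e j)
  simpa [norm_e] using this

theorem IsSmoothLimit.tendsto_shiftSq (hu : SpacePeriodic u) (hu2 : MemLp u 2 μT)
    (h : IsSmoothLimit u) : Tendsto (shiftSq u) (𝓝 0) (𝓝 0) := by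
  have hE : Tendsto (fun y => eLpNorm (fun x => u (x + y) - u x) 2 μT) (𝓝 0) (𝓝 0) := by
    rw [ENNReal.tendsto_nhds_zero]
    intro ε hε
    have hε4 : 0 < ε / 4 := ENNReal.div_pos hε.ne' (by norm_num)
    obtain ⟨w, hw, hc, hle⟩ := h (ε / 4) hε4
    have hD : eLpNorm (fderiv ℝ w) 2 μT ≠ ⊤ :=
      (hw.fderiv.memLp_of_continuous (hc.continuous_fderiv (by simp)) 2).2.ne
    have hlim : Tendsto (fun y : E3 => ENNReal.ofReal ‖y‖ * eLpNorm (fderiv ℝ w) 2 μT)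
        (𝓝 0) (𝓝 0) := by
      have h1 : Tendsto (fun y : E3 => ENNReal.ofReal ‖y‖) (𝓝 0) (𝓝 0) := by
        have := (ENNReal.continuous_ofReal.comp (continuous_norm (E := E3))).tendsto 0
        simpa only [Function.comp_def, norm_zero, ENNReal.ofReal_zero] using this
      have := ENNReal.Tendsto.mul_const h1 (Or.inr hD)
      simpa using this
    have hε2 : 0 < ε / 2 := ENNReal.div_pos hε.ne' (by norm_num)
    filter_upwards [(ENNReal.tendsto_nhds_zero.1 hlim) (ε / 2) hε2] with y hy
    calc _ ≤ _ := eLpNorm_shift_le hu hu2 hw hc y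
      _ ≤ 2 * (ε / 4) + ε / 2 := by gcongr
      _ = ε := by
        have : 2 * (ε / 4) = ε / 2 := by
          rw [show (4 : ℝ≥0∞) = 2 * 2 by norm_num, div_eq_mul_inv, div_eq_mul_inv,
            ENNReal.mul_inv (by norm_num) (by norm_num)]
          calc 2 * (ε * (2⁻¹ * 2⁻¹)) = (2 * 2⁻¹) * (ε * 2⁻¹) := by ring
            _ = _ := by rw [ENNReal.mul_inv_cancel (by norm_num) (by norm_num), one_mul]
        rw [this, ENNReal.add_halves]
  have h2 := ((ENNReal.tendsto_toReal ENNReal.zero_ne_top).comp hE).pow 2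
  simp only [ENNReal.toReal_zero, ne_eq, OfNat.ofNat_ne_zero, not_false_eq_true, zero_pow] at h2
  exact h2.congr fun y => (shiftSq_eq_eLpNorm hu hu2 y).symm

end Correlation

/-! ### The energy flux through a scale -/

/-- By translation invariance, the integral over the torus of `g(x + h) - g(x)` vanishes, and it is
the integral of the derivative along `h`. -/
theorem integral_fderiv_eq_zero {g : E3 → ℝ} (hg : SpacePeriodic g) (hc : ContDiff ℝ ∞ g)
    (h : E3) : ∫ x, fderiv ℝ g x h ∂μT = 0 := by
  have hDc : Continuous (fderiv ℝ g) := hc.continuous_fderiv (by simp)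
  have hper : SpacePeriodic fun x => fderiv ℝ g x h := fun x i => by simp only [hg.fderiv x i]
  obtain ⟨C, -, hC⟩ := hper.bounded_of_continuous (hDc.clm_apply continuous_const)
  have hJc : Continuous fun p : E3 × ℝ => fderiv ℝ g (p.1 + p.2 • h) h :=
    (hDc.comp (by fun_prop)).clm_apply continuous_const
  have hJi : Integrable (fun p : E3 × ℝ => fderiv ℝ g (p.1 + p.2 • h) h)
      (μT.prod (volume.restrict (Ioc (0 : ℝ) 1))) :=
    Integrable.of_bound hJc.aestronglyMeasurable C (Eventually.of_forall fun p => hC _)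
  have hswap := integral_integral_swap (f := fun x s => fderiv ℝ g (x + s • h) h) hJi
  have hftc : ∀ x, ∫ s in Ioc (0 : ℝ) 1, fderiv ℝ g (x + s • h) h = g (x + h) - g x := fun x => by
    rw [← intervalIntegral.integral_of_le zero_le_one,
      intervalIntegral.integral_eq_sub_of_hasDerivAt (f := fun s => g (x + s • h))]
    · simp
    · intro s _
      have h2 : HasDerivAt (fun s : ℝ => x + s • h) h s := by
        simpa using ((hasDerivAt_id s).smul_const h).const_add x
      exact ((hc.differentiable (by simp)) (x + s • h)).hasFDerivAt.comp_hasDerivAt s h2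
    · exact Continuous.intervalIntegrable
        ((hDc.comp (by fun_prop)).clm_apply continuous_const) _ _
  have hin : ∀ s : ℝ, ∫ x, fderiv ℝ g (x + s • h) h ∂μT = ∫ x, fderiv ℝ g x h ∂μT :=
    fun s => hper.integral_add_right _
  have hgi := hg.integrable_of_continuous hc.continuous
  simp only [hin, hftc, integral_const, Measure.real, Measure.restrict_apply_univ,
    Real.volume_Ioc, sub_zero, ENNReal.ofReal_one, ENNReal.toReal_one, one_smul] at hswap
  rw [← hswap, integral_sub (hg.integrable_add_right hgi h) hgi, hg.integral_add_right, sub_self]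

theorem tendsto_integral_of_norm_sub_le {F : Type*} [NormedAddCommGroup F] [NormedSpace ℝ F]
    {f : E3 → F} {f' : ℕ → E3 → F} {g : ℕ → E3 → ℝ} (C : ℝ) (hf : Integrable f μT)
    (hf' : ∀ n, Integrable (f' n) μT) (hg : ∀ n, Integrable (g n) μT)
    (hle : ∀ n x, ‖f x - f' n x‖ ≤ C * g n x)
    (hlim : Tendsto (fun n => ∫ x, g n x ∂μT) atTop (𝓝 0)) :
    Tendsto (fun n => ∫ x, f' n x ∂μT) atTop (𝓝 (∫ x, f x ∂μT)) := by
  rw [tendsto_iff_norm_sub_tendsto_zero]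
  refine squeeze_zero (fun _ => norm_nonneg _) (fun n => ?_) (by simpa using hlim.const_mul C)
  rw [norm_sub_rev, ← integral_sub hf (hf' n), ← integral_const_mul]
  exact (norm_integral_le_integral_norm _).trans
    (integral_mono (hf.sub (hf' n)).norm ((hg n).const_mul C) (hle n))

section Flux

variable {k : E3 → ℝ} {u : E3 → E3} {w : ℕ → E3 → E3}

/-- A solenoidal field is orthogonal to the gradients. -/
theorem IsSolenoidalLimit.integral_fderiv_apply (hu : IsSolenoidalLimit u w) {ψ : E3 → ℝ}
    (hψ : SpacePeriodic ψ) (hc : ContDiff ℝ ∞ ψ) : ∫ x, fderiv ℝ ψ x (u x) ∂μT = 0 := by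
  have hDc : Continuous (fderiv ℝ ψ) := hc.continuous_fderiv (by simp)
  obtain ⟨C, hC0, hC⟩ := hψ.fderiv.bounded_of_continuous hDc
  have hint : ∀ {g : E3 → E3}, Integrable g μT → Integrable (fun x => fderiv ℝ ψ x (g x)) μT :=
    fun hg => (hg.norm.const_mul C).mono'
      ((ContinuousLinearMap.id ℝ (E3 →L[ℝ] ℝ)).aestronglyMeasurable_comp₂
        hDc.aestronglyMeasurable hg.1)
      (Eventually.of_forall fun x => (ContinuousLinearMap.le_opNorm _ _).trans
        (mul_le_mul_of_nonneg_right (hC x) (norm_nonneg _)))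
  have hlim : Tendsto (fun n => ∫ x, fderiv ℝ ψ x (w n x) ∂μT) atTop
      (𝓝 (∫ x, fderiv ℝ ψ x (u x) ∂μT)) := by
    refine tendsto_integral_of_norm_sub_le C (hint hu.integrable)
      (fun n => hint (hu.solenoidal n).integrable)
      (fun n => (hu.integrable.sub (hu.solenoidal n).integrable).norm) (fun n x => ?_) hu.tendsto
    rw [← map_sub]
    exact (ContinuousLinearMap.le_opNorm _ _).trans
      (mul_le_mul_of_nonneg_right (hC x) (norm_nonneg _))
  have hz : ∀ n, ∫ x, fderiv ℝ ψ x (w n x) ∂μT = 0 := fun n => by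
    have hw := hu.solenoidal n
    have hd : Differentiable ℝ (w n) := hw.smooth.differentiable (by simp)
    have hwj : ∀ j, ContDiff ℝ ∞ fun x => (w n x) j := fun j =>
      (EuclideanSpace.proj (𝕜 := ℝ) j).contDiff.comp hw.smooth
    have hgper : ∀ j, SpacePeriodic fun x => (w n x) j * ψ x := fun j x i => by
      simp only [hw.periodic x i, hψ x i]
    have hgc : ∀ j, ContDiff ℝ ∞ fun x => (w n x) j * ψ x := fun j => (hwj j).mul hc
    have hsum : ∀ x, fderiv ℝ ψ x (w n x) =
        ∑ j, fderiv ℝ (fun x => (w n x) j * ψ x) x (e j) := fun x => by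
      have h1 : ∀ j, fderiv ℝ (fun x => (w n x) j) x (e j) = (fderiv ℝ (w n) x (e j)) j :=
        fun j => by
          have := ((EuclideanSpace.proj (𝕜 := ℝ) j).hasFDerivAt.comp x (hd x).hasFDerivAt).fderiv
          exact congrArg (fun L : E3 →L[ℝ] ℝ => L (e j)) this
      have h2 : ∀ j, fderiv ℝ (fun x => (w n x) j * ψ x) x (e j) =
          (w n x) j * fderiv ℝ ψ x (e j) + ψ x * (fderiv ℝ (w n) x (e j)) j := fun j => by
        rw [fderiv_fun_mul ((hwj j).differentiable (by simp) x)
          (hc.differentiable (by simp) x), ← h1 j]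
        simp
      have h3 := hw.div_free x
      rw [divergence] at h3
      simp only [h2, Finset.sum_add_distrib, ← Finset.mul_sum, h3, mul_zero, add_zero]
      simpa using clm_eq_sum (fderiv ℝ ψ x) (w n x)
    simp only [hsum]
    rw [integral_finsetSum]
    · exact Finset.sum_eq_zero fun j _ => integral_fderiv_eq_zero (hgper j) (hgc j) _
    · intro j _
      refine SpacePeriodic.integrable_of_continuous
        (fun x i => by simp only [(hgper j).fderiv x i]) ?_
      exact ((hgc j).continuous_fderiv (by simp)).clm_apply continuous_const
  simp only [hz] at hlim
  exact tendsto_nhds_unique hlim tendsto_const_nhds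

/-- Integration by parts in the convective term, for a continuous Sobolev field. -/
theorem MemV.scal_convective {A : E3 → E3 →L[ℝ] E3} (hu : MemV u A) (huc : Continuous u)
    {φ : E3 → E3} (hφ : SpacePeriodic φ) (hc : ContDiff ℝ ∞ φ) :
    scal (fun x => A x (u x)) φ = -∫ x, inner ℝ (u x) (fderiv ℝ φ x (u x)) ∂μT := by
  obtain ⟨w, hw, hA⟩ := hu.exists_limit
  have hDc : Continuous (fderiv ℝ φ) := hc.continuous_fderiv (by simp)
  obtain ⟨M, hM0, hM⟩ := hφ.bounded_of_continuous hc.continuous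
  obtain ⟨M', hM'0, hM'⟩ := hφ.fderiv.bounded_of_continuous hDc
  obtain ⟨U, hU0, hU⟩ := hu.periodic.bounded_of_continuous huc
  have hAi : Integrable A μT := hu.memLp_grad.integrable (by norm_num)
  have hDi : ∀ n, Integrable (fderiv ℝ (w n)) μT := fun n =>
    (hw.solenoidal n).memLp_fderiv.integrable (by norm_num)
  have hb1 : ∀ (L : E3 →L[ℝ] E3) x, ‖inner ℝ (L (u x)) (φ x)‖ ≤ U * M * ‖L‖ := fun L x => by
    calc _ ≤ ‖L (u x)‖ * ‖φ x‖ := norm_inner_le_norm _ _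
      _ ≤ (‖L‖ * U) * M := by
        gcongr
        · exact (L.le_opNorm _).trans (by gcongr; exact hU x)
        · exact hM x
      _ = _ := by ring
  have hb2 : ∀ (a : E3) x, ‖inner ℝ a (fderiv ℝ φ x (u x))‖ ≤ M' * U * ‖a‖ := fun a x => by
    calc _ ≤ ‖a‖ * ‖fderiv ℝ φ x (u x)‖ := norm_inner_le_norm _ _
      _ ≤ ‖a‖ * (M' * U) := by
        gcongr
        exact (ContinuousLinearMap.le_opNorm _ _).trans
          (mul_le_mul (hM' x) (hU x) (norm_nonneg _) hM'0)
      _ = _ := by ring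
  have hi1 : ∀ {B : E3 → E3 →L[ℝ] E3}, Integrable B μT →
      Integrable (fun x => inner ℝ (B x (u x)) (φ x)) μT := fun hB =>
    (hB.norm.const_mul (U * M)).mono'
      (((ContinuousLinearMap.id ℝ (E3 →L[ℝ] E3)).aestronglyMeasurable_comp₂ hB.1
        huc.aestronglyMeasurable).inner hc.continuous.aestronglyMeasurable)
      (Eventually.of_forall fun x => hb1 _ x)
  have hi2 : ∀ {g : E3 → E3}, Integrable g μT →
      Integrable (fun x => inner ℝ (g x) (fderiv ℝ φ x (u x))) μT := fun hg =>
    (hg.norm.const_mul (M' * U)).mono'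
      (hg.1.inner (hDc.clm_apply huc).aestronglyMeasurable)
      (Eventually.of_forall fun x => hb2 _ x)
  have hl1 : Tendsto (fun n => ∫ x, inner ℝ (fderiv ℝ (w n) x (u x)) (φ x) ∂μT) atTop
      (𝓝 (∫ x, inner ℝ (A x (u x)) (φ x) ∂μT)) := by
    refine tendsto_integral_of_norm_sub_le (U * M) (hi1 hAi) (fun n => hi1 (hDi n))
      (fun n => (hAi.sub (hDi n)).norm) (fun n x => ?_) hA
    rw [← inner_sub_left, ← sub_apply]
    exact hb1 _ x
  have hl2 : Tendsto (fun n => ∫ x, inner ℝ (w n x) (fderiv ℝ φ x (u x)) ∂μT) atTop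
      (𝓝 (∫ x, inner ℝ (u x) (fderiv ℝ φ x (u x)) ∂μT)) := by
    refine tendsto_integral_of_norm_sub_le (M' * U) (hi2 hw.integrable)
      (fun n => hi2 (hw.solenoidal n).integrable)
      (fun n => (hw.integrable.sub (hw.solenoidal n).integrable).norm) (fun n x => ?_) hw.tendsto
    rw [← inner_sub_left]
    exact hb2 _ x
  have hz : ∀ n, ∫ x, inner ℝ (fderiv ℝ (w n) x (u x)) (φ x) ∂μT =
      -∫ x, inner ℝ (w n x) (fderiv ℝ φ x (u x)) ∂μT := fun n => by
    have hs := hw.solenoidal n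
    have h0 := hw.integral_fderiv_apply (ψ := fun x => inner ℝ (w n x) (φ x))
      (fun x i => by simp only [hs.periodic x i, hφ x i]) (hs.smooth.inner ℝ hc)
    have h1 : ∀ x, fderiv ℝ (fun x => inner ℝ (w n x) (φ x)) x (u x) =
        inner ℝ (w n x) (fderiv ℝ φ x (u x)) + inner ℝ (fderiv ℝ (w n) x (u x)) (φ x) := fun x =>
      fderiv_inner_apply ℝ (hs.smooth.differentiable (by simp) x)
        (hc.differentiable (by simp) x) _
    simp only [h1] at h0
    rw [integral_add (hi2 hs.integrable) (hi1 (hDi n))] at h0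
    linarith
  simp only [hz] at hl1
  exact tendsto_nhds_unique hl1 hl2.neg

/-- The Duchon–Robert form of the energy flux: it is a mean of cubic expressions in the
translation differences of the velocity alone. -/
theorem MemV.four_mul_flux {A : E3 → E3 →L[ℝ] E3} (hu : MemV u A) (huc : Continuous u)
    (hk : IsKernel k) (heven : ∀ y, k (-y) = k y) :
    4 * scal (fun x => A x (u x)) (mollify k u) =
      ∫ y, ∫ x, fderiv ℝ k y (u (x + y) - u x) * ‖u (x + y) - u x‖ ^ 2 ∂μT := by
  obtain ⟨w, hw, -⟩ := hu.exists_limit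
  have hui := hw.integrable
  have hper := hu.periodic
  have hkc := hk.continuous_fderiv
  have hodd : ∀ y, fderiv ℝ k (-y) = -fderiv ℝ k y := fun y => by
    rw [← fderiv_comp_neg (hk.smooth.differentiable (by simp)) y]
    simp only [heven]
  -- Every integrand below is continuous and vanishes for large `y`.
  have hint : ∀ {a b : E3 × E3 → E3}, Continuous a → Continuous b →
      ∀ {c : E3 × E3 → E3}, Continuous c →
      Integrable (fun p : E3 × E3 => fderiv ℝ k p.2 (a p) * inner ℝ (b p) (c p))
        (μT.prod volume) := fun ha hb c hc =>
    integrable_prod_of_continuous (by fun_prop) fun x y hy => by simp [hk.fderiv_eq_zero hy]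
  -- For fixed `y`, the integrals over `x` of `∇k(y) · u(x)` times `u · u(x + y)`, `|u|²`,
  -- `|u(x + y)|²` and `|u(x + y) - u|²`. By polarisation `d = b + c - 2a`; the `y`-integrals of `b`
  -- and `c` vanish, and that of `a` is the flux.
  set a : E3 → ℝ := fun y => ∫ x, fderiv ℝ k y (u x) * inner ℝ (u x) (u (x + y)) ∂μT with ha
  set b : E3 → ℝ := fun y => ∫ x, fderiv ℝ k y (u x) * inner ℝ (u x) (u x) ∂μT with hb
  set c : E3 → ℝ := fun y => ∫ x, fderiv ℝ k y (u x) * inner ℝ (u (x + y)) (u (x + y)) ∂μT with hc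
  set d : E3 → ℝ := fun y => ∫ x, fderiv ℝ k y (u x) *
    inner ℝ (u (x + y) - u x) (u (x + y) - u x) ∂μT with hd
  have hpa := hint (a := fun p => u p.1) (b := fun p => u p.1) (by fun_prop) (by fun_prop)
    (c := fun p => u (p.1 + p.2)) (by fun_prop)
  have hpb := hint (a := fun p => u p.1) (b := fun p => u p.1) (by fun_prop) (by fun_prop)
    (c := fun p => u p.1) (by fun_prop)
  have hpc := hint (a := fun p => u p.1) (b := fun p => u (p.1 + p.2)) (by fun_prop) (by fun_prop)
    (c := fun p => u (p.1 + p.2)) (by fun_prop)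
  have hpd := hint (a := fun p => u p.1) (b := fun p => u (p.1 + p.2) - u p.1) (by fun_prop)
    (by fun_prop) (c := fun p => u (p.1 + p.2) - u p.1) (by fun_prop)
  have hai : Integrable a := hpa.integral_prod_right
  have hbi : Integrable b := hpb.integral_prod_right
  have hci : Integrable c := hpc.integral_prod_right
  have hdi : Integrable d := hpd.integral_prod_right
  -- For fixed `y` the integrals over the torus converge as well.
  have hT : ∀ {f : E3 → ℝ}, SpacePeriodic f → Continuous f → Integrable f μT :=
    fun hf hfc => hf.integrable_of_continuous hfc
  have hshift : ∀ y, SpacePeriodic fun x => u (x + y) := fun y => hper.add_right y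
  have hdabc : ∀ y, d y = b y + c y - 2 * a y := fun y => by
    have h1 : ∀ x, fderiv ℝ k y (u x) * inner ℝ (u (x + y) - u x) (u (x + y) - u x) =
        fderiv ℝ k y (u x) * inner ℝ (u x) (u x) +
        fderiv ℝ k y (u x) * inner ℝ (u (x + y)) (u (x + y)) -
        2 * (fderiv ℝ k y (u x) * inner ℝ (u x) (u (x + y))) := fun x => by
      rw [inner_sub_left, inner_sub_right, inner_sub_right, real_inner_comm (u x) (u (x + y))]
      ring
    have i1 : Integrable (fun x => fderiv ℝ k y (u x) * inner ℝ (u x) (u x)) μT :=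
      hT (fun x i => by simp only [hper x i]) (by fun_prop)
    have i2 : Integrable (fun x => fderiv ℝ k y (u x) * inner ℝ (u (x + y)) (u (x + y))) μT :=
      hT (fun x i => by simp only [hper x i, hshift y x i]) (by fun_prop)
    have i3 : Integrable (fun x => fderiv ℝ k y (u x) * inner ℝ (u x) (u (x + y))) μT :=
      hT (fun x i => by simp only [hper x i, hshift y x i]) (by fun_prop)
    simp only [hd, ha, hb, hc, h1]
    exact integral_add_sub_two_mul i1 i2 i3
  -- The gradient of an even kernel is odd.
  have hb0 : ∫ y, b y = 0 := by
    have h1 : ∀ y, b (-y) = -b y := fun y => by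
      simp only [hb, hodd, neg_apply, neg_mul, integral_neg]
    have h2 := integral_neg_eq_self b (volume : Measure E3)
    simp only [h1, integral_neg] at h2
    linarith
  -- After a translation, `c` contains the divergence of the mollified field.
  have hc0 : ∫ y, c y = 0 := by
    have h1 : ∀ y, c (-y) = -∫ x, fderiv ℝ k y (u (x + y)) * inner ℝ (u x) (u x) ∂μT := fun y => by
      have hp : SpacePeriodic fun x => fderiv ℝ k y (u x) * inner ℝ (u (x + -y)) (u (x + -y)) :=
        fun x i => by simp only [hper x i, hshift (-y) x i]
      have := hp.integral_add_right y
      simp only [add_neg_cancel_right] at this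
      simp only [hc, hodd, neg_apply, neg_mul, integral_neg, this]
    have h2 := integral_neg_eq_self c (volume : Measure E3)
    have hp := hint (a := fun p => u (p.1 + p.2)) (b := fun p => u p.1) (by fun_prop) (by fun_prop)
      (c := fun p => u p.1) (by fun_prop)
    have h3 := integral_integral_swap
      (f := fun x y => fderiv ℝ k y (u (x + y)) * inner ℝ (u x) (u x)) hp
    have h4 : ∀ x, ∫ y, fderiv ℝ k y (u (x + y)) = 0 := fun x => by
      have h5 := hw.divergence_mollify hk x
      have h6 : ∀ j, (mollify (fun y => fderiv ℝ k y (e j)) u x) j =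
          ∫ y, fderiv ℝ k y (e j) * (u (x + y)) j := fun j => by
        have := (EuclideanSpace.proj (𝕜 := ℝ) j).integral_comp_comm
          ((hk.fderiv_apply (e j)).integrable_smul hper hui x)
        simpa [mollify] using this.symm
      simp only [divergence, TorusNS.fderiv_mollify hk hper hui, PiLp.neg_apply, Finset.sum_neg_distrib,
        neg_eq_zero, h6] at h5
      rw [← integral_finsetSum _ fun j _ => by
        simpa using (EuclideanSpace.proj (𝕜 := ℝ) j).integrable_comp
          ((hk.fderiv_apply (e j)).integrable_smul hper hui x)] at h5
      rw [← h5]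
      congr 1
      funext y
      rw [clm_eq_sum]
      simp [mul_comm]
    simp only [integral_mul_const, h4, zero_mul, integral_zero] at h3
    simp only [h1, integral_neg] at h2
    rw [← h2, ← h3, neg_zero]
  have hda : ∫ y, d y = -2 * ∫ y, a y := by
    simp only [hdabc]
    rw [integral_add_sub_two_mul hbi hci hai, hb0, hc0]
    ring
  -- Combining `y` and `-y` turns the factor `u(x)` into a translation difference.
  have hq : ∀ y, ∫ x, fderiv ℝ k y (u (x + y) - u x) * ‖u (x + y) - u x‖ ^ 2 ∂μT =
      -d (-y) - d y := fun y => by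
    have hp : SpacePeriodic fun x => fderiv ℝ k y (u x) *
        inner ℝ (u (x + -y) - u x) (u (x + -y) - u x) :=
      fun x i => by simp only [hper x i, hshift (-y) x i]
    have h1 := hp.integral_add_right y
    simp only [add_neg_cancel_right] at h1
    have i1 : Integrable (fun x => fderiv ℝ k y (u (x + y)) *
        inner ℝ (u x - u (x + y)) (u x - u (x + y))) μT :=
      hT (fun x i => by simp only [hper x i, hshift y x i]) (by fun_prop)
    have i2 : Integrable (fun x => fderiv ℝ k y (u x) *
        inner ℝ (u (x + y) - u x) (u (x + y) - u x)) μT :=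
      hT (fun x i => by simp only [hper x i, hshift y x i]) (by fun_prop)
    simp only [hd, hodd, neg_apply, neg_mul, integral_neg, neg_neg]
    rw [← h1, ← integral_sub i1 i2]
    congr 1
    funext x
    rw [real_inner_self_eq_norm_sq, real_inner_self_eq_norm_sq, norm_sub_rev (u x), map_sub]
    ring
  have hTa : scal (fun x => A x (u x)) (mollify k u) = ∫ y, a y := by
    rw [hu.scal_convective huc (hper.mollify k) (contDiff_mollify hk hper hui), ← integral_neg]
    have h1 : ∀ x, -inner ℝ (u x) (fderiv ℝ (mollify k u) x (u x)) =
        ∫ y, fderiv ℝ k y (u x) * inner ℝ (u x) (u (x + y)) := fun x => by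
      rw [TorusNS.fderiv_mollify hk hper hui, inner_neg_right, neg_neg, mollify,
        ← integral_inner ((hk.fderiv_apply (u x)).integrable_smul hper hui x)]
      simp only [inner_smul_right]
    simp only [h1]
    exact integral_integral_swap
      (f := fun x y => fderiv ℝ k y (u x) * inner ℝ (u x) (u (x + y))) hpa
  simp only [hq]
  have h := integral_sub hdi.comp_neg.neg hdi
  simp only [Pi.neg_apply] at h
  rw [h, integral_neg, integral_neg_eq_self d, hda, hTa]
  ring

end Flux

/-! ### Mollifiers at scale `r` -/

/-- An even probability density supported in the ball of radius `r`. -/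
structure IsMollifier (k : E3 → ℝ) (r : ℝ) : Prop extends IsKernel k where
  even : ∀ y, k (-y) = k y
  nonneg : ∀ y, 0 ≤ k y
  integral_eq_one : ∫ y, k y = 1
  eq_zero_of_lt : ∀ y, r < ‖y‖ → k y = 0

/-- Scaling one bump function yields mollifiers whose gradients have `L¹` norm of order `1 / r`. -/
theorem exists_isMollifier : ∃ C : ℝ, 0 ≤ C ∧ ∀ r : ℝ, 0 < r → r ≤ 1 →
    ∃ k, IsMollifier k r ∧ ∫ y, ‖fderiv ℝ k y‖ ≤ C / r := by
  let φ : ContDiffBump (0 : E3) := ⟨1 / 2, 1, by norm_num, by norm_num⟩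
  set k₀ : E3 → ℝ := φ.normed volume with hk₀
  have hs : ContDiff ℝ ∞ k₀ := φ.contDiff_normed
  have h0 : ∀ y, 1 < ‖y‖ → k₀ y = 0 := fun y hy => by
    have : y ∉ Function.support k₀ := by
      rw [hk₀, φ.support_normed_eq, mem_ball_zero_iff]
      exact not_lt.2 hy.le
    simpa using this
  refine ⟨∫ y, ‖fderiv ℝ k₀ y‖, integral_nonneg fun _ => norm_nonneg _, fun r hr hr1 => ?_⟩
  have hscale : ∀ {y : E3}, r < ‖y‖ → 1 < ‖r⁻¹ • y‖ := fun {y} hy => by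
    rw [norm_smul, norm_inv, Real.norm_of_nonneg hr.le, inv_mul_eq_div, one_lt_div hr]
    exact hy
  have hz : ∀ y, r < ‖y‖ → r⁻¹ ^ 3 * k₀ (r⁻¹ • y) = 0 := fun y hy => by
    rw [h0 _ (hscale hy), mul_zero]
  have hint : ∀ f : E3 → ℝ, ∫ y, f (r⁻¹ • y) = r ^ 3 * ∫ y, f y := fun f => by
    rw [Measure.integral_comp_inv_smul, finrank_euclideanSpace_fin, abs_of_pos (by positivity),
      smul_eq_mul]
  refine ⟨fun y => r⁻¹ ^ 3 * k₀ (r⁻¹ • y), ⟨⟨?_, fun y hy => hz y (hr1.trans_lt hy)⟩, fun y => ?_,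
    fun y => mul_nonneg (by positivity) (φ.nonneg_normed _), ?_, hz⟩, ?_⟩
  · exact contDiff_const.mul (hs.comp (contDiff_const_smul _))
  · simp only [smul_neg, hk₀, φ.normed_neg]
  · rw [integral_const_mul, hint, hk₀, φ.integral_normed]
    field_simp
  · have hd : ∀ y, fderiv ℝ (fun y => r⁻¹ ^ 3 * k₀ (r⁻¹ • y)) y =
        (r⁻¹ ^ 3 * r⁻¹) • fderiv ℝ k₀ (r⁻¹ • y) := fun y => by
      have h1 := ((hs.differentiable (by simp) (r⁻¹ • y)).hasFDerivAt.comp y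
        ((hasFDerivAt_id y).const_smul r⁻¹)).const_mul (r⁻¹ ^ 3)
      refine h1.fderiv.trans ?_
      ext h
      simp [mul_assoc]
    have hn : ∀ y, ‖fderiv ℝ (fun y => r⁻¹ ^ 3 * k₀ (r⁻¹ • y)) y‖ =
        (r⁻¹ ^ 3 * r⁻¹) * ‖fderiv ℝ k₀ (r⁻¹ • y)‖ := fun y => by
      rw [hd, norm_smul, Real.norm_of_nonneg (by positivity)]
    simp only [hn]
    rw [integral_const_mul, hint fun z => ‖fderiv ℝ k₀ z‖]
    apply le_of_eq
    field_simp

namespace IsMollifier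

variable {k : E3 → ℝ} {r : ℝ} {u : E3 → E3}

theorem integrable_mul_shiftSq (hk : IsMollifier k r) (hu : SpacePeriodic u) (hu2 : MemLp u 2 μT) :
    Integrable fun y => k y * shiftSq u y :=
  TorusNS.integrable_mul_shiftSq hk.integrable hu hu2

theorem scal_mollify_self_le (hk : IsMollifier k r) (hu : SpacePeriodic u) (hu2 : MemLp u 2 μT) :
    scal u (mollify k u) ≤ normSq u := by
  rw [scal_mollify_self hk.toIsKernel hk.integral_eq_one hu hu2]
  have : 0 ≤ ∫ y, k y * shiftSq u y :=
    integral_nonneg fun y => mul_nonneg (hk.nonneg y) (shiftSq_nonneg u y)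
  linarith

theorem le_scal_mollify_self (hk : IsMollifier k r) (hu : SpacePeriodic u) (hu2 : MemLp u 2 μT)
    {η : ℝ} (hη : ∀ y, ‖y‖ ≤ r → shiftSq u y ≤ η) :
    normSq u - (1 / 2) * η ≤ scal u (mollify k u) := by
  rw [scal_mollify_self hk.toIsKernel hk.integral_eq_one hu hu2]
  have : ∫ y, k y * shiftSq u y ≤ ∫ y, k y * η := by
    refine integral_mono (hk.integrable_mul_shiftSq hu hu2) (hk.integrable.mul_const η) fun y => ?_
    rcases le_or_gt ‖y‖ r with hy | hy
    · exact mul_le_mul_of_nonneg_left (hη y hy) (hk.nonneg y)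
    · simp [hk.eq_zero_of_lt y hy]
  rw [integral_mul_const, hk.integral_eq_one, one_mul] at this
  linarith

theorem neg_normSq_le_scal_mollify_self (hk : IsMollifier k r) (hu : SpacePeriodic u)
    (hu2 : MemLp u 2 μT) : -normSq u ≤ scal u (mollify k u) := by
  have := hk.le_scal_mollify_self hu hu2 fun y _ => shiftSq_le hu hu2 y
  linarith

/-- A Hölder bound for one of the three translation differences in the Duchon–Robert formula, and
the `L²` norm for the other two. -/
theorem abs_flux_le (hk : IsMollifier k r) {A : E3 → E3 →L[ℝ] E3}
    (hu : MemV u A) (huc : Continuous u) {α f S : ℝ} (hα : 0 ≤ α) (hf : 0 ≤ f)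
    (hH : ∀ x y, ‖u x - u y‖ ≤ f * ‖x - y‖ ^ α) (hS : ∀ y, ‖y‖ ≤ r → shiftSq u y ≤ S) :
    |scal (fun x => A x (u x)) (mollify k u)| ≤
      (∫ y, ‖fderiv ℝ k y‖) * (f * r ^ α * S) := by
  have hDi : Integrable fun y => ‖fderiv ℝ k y‖ :=
    (hk.continuous_fderiv.integrable_of_hasCompactSupport
      (hk.hasCompactSupport.fderiv ℝ)).norm
  have hy : ∀ y, ‖∫ x, fderiv ℝ k y (u (x + y) - u x) * ‖u (x + y) - u x‖ ^ 2 ∂μT‖ ≤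
      ‖fderiv ℝ k y‖ * (f * r ^ α * S) := fun y => by
    rcases le_or_gt ‖y‖ r with hyr | hyr
    · have hδ : MemLp (fun x => u (x + y) - u x) 2 μT :=
        (hu.periodic.memLp_add_right hu.memLp y).sub hu.memLp
      have hpow : f * ‖y‖ ^ α ≤ f * r ^ α :=
        mul_le_mul_of_nonneg_left (Real.rpow_le_rpow (norm_nonneg _) hyr hα) hf
      have h0 : 0 ≤ ‖fderiv ℝ k y‖ * (f * r ^ α) :=
        mul_nonneg (norm_nonneg _) (le_trans (by positivity) hpow)
      calc _ ≤ ∫ x, ‖fderiv ℝ k y‖ * (f * r ^ α) * ‖u (x + y) - u x‖ ^ 2 ∂μT := by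
            refine norm_integral_le_of_norm_le ((integrable_norm_sq hδ).const_mul _)
              (Eventually.of_forall fun x => ?_)
            rw [norm_mul, norm_pow, norm_norm]
            gcongr
            refine (ContinuousLinearMap.le_opNorm _ _).trans ?_
            gcongr
            have := hH (x + y) x
            rw [add_sub_cancel_left] at this
            exact this.trans hpow
        _ = ‖fderiv ℝ k y‖ * (f * r ^ α) * shiftSq u y := by
            rw [integral_const_mul]; rfl
        _ ≤ ‖fderiv ℝ k y‖ * (f * r ^ α) * S := mul_le_mul_of_nonneg_left (hS y hyr) h0
        _ = _ := by ring
    · simp [fderiv_eq_zero_of_lt_norm hk.eq_zero_of_lt hyr]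
  have h4 := hu.four_mul_flux huc hk.toIsKernel hk.even
  have h5 := norm_integral_le_of_norm_le (hDi.mul_const (f * r ^ α * S)) (Eventually.of_forall hy)
  rw [← h4, integral_mul_const, Real.norm_eq_abs, abs_mul, abs_of_pos (by norm_num : (0 : ℝ) < 4)] at h5
  have := abs_nonneg (scal (fun x => A x (u x)) (mollify k u))
  linarith

end IsMollifier

theorem tendsto_scal_mollify {k : ℕ → E3 → ℝ} {r : ℕ → ℝ} (hk : ∀ n, IsMollifier (k n) (r n))
    (hr : Tendsto r atTop (𝓝 0)) {u : E3 → E3} (hu : SpacePeriodic u) (hu2 : MemLp u 2 μT)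
    (hs : IsSmoothLimit u) :
    Tendsto (fun n => scal u (mollify (k n) u)) atTop (𝓝 (normSq u)) := by
  rw [Metric.tendsto_atTop]
  intro η hη
  obtain ⟨δ, hδ, hball⟩ := Metric.eventually_nhds_iff.1
    ((hs.tendsto_shiftSq hu hu2).eventually (gt_mem_nhds hη))
  obtain ⟨N, hN⟩ := eventually_atTop.1 (hr.eventually (gt_mem_nhds hδ))
  refine ⟨N, fun n hn => ?_⟩
  have h1 := (hk n).le_scal_mollify_self hu hu2 (η := η) fun y hy =>
    (hball (by rw [dist_zero_right]; exact hy.trans_lt (hN n hn))).le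
  have h2 := (hk n).scal_mollify_self_le hu hu2
  rw [Real.dist_eq, abs_lt]
  constructor <;> linarith

/-! ### Evolution in time -/

/-- A continuous function whose weak derivative on `[0, T)` is `-N`, with initial value `c` in the
weak sense, is `c - ∫ N`. -/
theorem eq_sub_integral_of_weak_deriv {T c : ℝ} {U N : ℝ → ℝ} (hT : 0 < T)
    (hU : ContinuousOn U (Icc 0 T)) (hN : IntegrableOn N (Ioo 0 T))
    (hweak : ∀ χ : ℝ → ℝ, ContDiff ℝ ∞ χ → (∃ T' < T, ∀ t, T' ≤ t → χ t = 0) →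
      ∫ t in Ioo 0 T, (deriv χ t * U t - χ t * N t) = -(χ 0 * c)) :
    ∀ t ∈ Icc 0 T, U t = c - ∫ s in (0 : ℝ)..t, N s := by
  set P : ℝ → ℝ := fun t => ∫ s in (0 : ℝ)..t, N s with hP
  have hNi : IntervalIntegrable N volume 0 T :=
    (intervalIntegrable_iff_integrableOn_Ioo_of_le hT.le).2 hN
  have hPc : ContinuousOn P (Icc 0 T) := by
    have := intervalIntegral.continuousOn_primitive_interval' hNi left_mem_uIcc
    rwa [uIcc_of_le hT.le] at this
  have hPac : AbsolutelyContinuousOnInterval P 0 T :=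
    hNi.absolutelyContinuousOnInterval_intervalIntegral left_mem_uIcc
  set W : ℝ → ℝ := fun t => U t + P t - c with hW
  have hWc : ContinuousOn W (Icc 0 T) := (hU.add hPc).sub continuousOn_const
  have key : ∀ ψ : ℝ → ℝ, ContDiff ℝ ∞ ψ → HasCompactSupport ψ → tsupport ψ ⊆ Ioo 0 T →
      ∫ t, ψ t • W t = 0 := by
    intro ψ hψ hψc hψs
    -- The primitive of `ψ` which vanishes at `T` is an admissible test function.
    set χ : ℝ → ℝ := fun t => ∫ s in T..t, ψ s with hχ
    have hχd : ∀ t, HasDerivAt χ (ψ t) t := fun t =>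
      intervalIntegral.integral_hasDerivAt_right (hψ.continuous.intervalIntegrable _ _)
        (hψ.continuous.stronglyMeasurableAtFilter _ _) hψ.continuous.continuousAt
    have hχ' : deriv χ = ψ := funext fun t => (hχd t).deriv
    have hχs : ContDiff ℝ ∞ χ := by
      rw [contDiff_infty_iff_deriv, hχ']
      exact ⟨fun t => (hχd t).differentiableAt, hψ⟩
    have hvan : ∃ T' < T, ∀ t, T' ≤ t → ψ t = 0 := by
      rcases (tsupport ψ).eq_empty_or_nonempty with he | hne
      · exact ⟨0, hT, fun t _ => image_eq_zero_of_notMem_tsupport (by simp [he])⟩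
      · obtain ⟨m, hm, hmax⟩ := hψc.isCompact.exists_isGreatest hne
        have hmT := (hψs hm).2
        refine ⟨(m + T) / 2, by linarith, fun t ht => image_eq_zero_of_notMem_tsupport fun h => ?_⟩
        have := hmax h
        linarith
    obtain ⟨T', hT', hψ0⟩ := hvan
    have hχ0 : ∀ t, T' ≤ t → χ t = 0 := fun t ht => by
      refine intervalIntegral.integral_zero_ae (Eventually.of_forall fun s hs => hψ0 s ?_)
      have := hs.1
      exact (le_inf hT'.le ht).trans this.le
    have hw := hweak χ hχs ⟨T', hT', hχ0⟩
    have hχac : AbsolutelyContinuousOnInterval χ 0 T := by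
      obtain ⟨K, hK⟩ := hχs.contDiffOn.exists_lipschitzOnWith (by simp) (convex_uIcc 0 T)
        isCompact_uIcc
      exact hK.absolutelyContinuousOnInterval
    have hibp := hPac.integral_mul_deriv_eq_deriv_mul hχac
    have hP0 : P 0 = 0 := intervalIntegral.integral_same
    have hdP : ∫ t in (0 : ℝ)..T, deriv P t * χ t = ∫ t in (0 : ℝ)..T, N t * χ t := by
      refine intervalIntegral.integral_congr_ae ?_
      filter_upwards [hNi.ae_hasDerivAt_integral] with t ht hmem
      rw [(ht (uIoc_subset_uIcc hmem) 0 left_mem_uIcc).deriv]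
    rw [hχ', hχ0 T hT'.le, hP0, hdP] at hibp
    have hψint : ∫ t in (0 : ℝ)..T, ψ t = -χ 0 := by
      rw [hχ, intervalIntegral.integral_symm]
    have hsupp : ∫ t, ψ t • W t = ∫ t in (0 : ℝ)..T, ψ t * W t := by
      rw [intervalIntegral.integral_of_le hT.le, integral_Ioc_eq_integral_Ioo]
      refine (setIntegral_eq_integral_of_forall_compl_eq_zero fun t ht => ?_).symm
      rw [image_eq_zero_of_notMem_tsupport fun h => ht (hψs h), zero_smul]
    have iU : IntervalIntegrable (fun t => ψ t * U t) volume 0 T :=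
      (hψ.continuous.continuousOn.mul (by rwa [uIcc_of_le hT.le])).intervalIntegrable
    have iP : IntervalIntegrable (fun t => P t * ψ t) volume 0 T :=
      ((by rwa [uIcc_of_le hT.le] : ContinuousOn P (uIcc 0 T)).mul
        hψ.continuous.continuousOn).intervalIntegrable
    have iN : IntervalIntegrable (fun t => N t * χ t) volume 0 T :=
      hNi.mul_continuousOn hχs.continuous.continuousOn
    rw [hχ', ← integral_Ioc_eq_integral_Ioo, ← intervalIntegral.integral_of_le hT.le] at hw
    have hsplit : ∫ t in (0 : ℝ)..T, ψ t * W t = (∫ t in (0 : ℝ)..T, (ψ t * U t - χ t * N t)) +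
        ((∫ t in (0 : ℝ)..T, N t * χ t) + (∫ t in (0 : ℝ)..T, P t * ψ t)) -
        c * ∫ t in (0 : ℝ)..T, ψ t := by
      have iN' : IntervalIntegrable (fun t => χ t * N t) volume 0 T := by
        simpa only [mul_comm] using iN
      have iψ : IntervalIntegrable (fun t => c * ψ t) volume 0 T :=
        (continuous_const.mul hψ.continuous).intervalIntegrable _ _
      rw [← intervalIntegral.integral_const_mul, ← intervalIntegral.integral_add iN iP,
        ← intervalIntegral.integral_add (iU.sub iN') (iN.add iP),
        ← intervalIntegral.integral_sub ((iU.sub iN').add (iN.add iP)) iψ]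
      congr 1
      funext t
      simp only [hW]
      ring
    rw [hsupp, hsplit, hw, hibp, hψint]
    ring
  have hae : ∀ᵐ t, t ∈ Ioo 0 T → W t = 0 := by
    refine isOpen_Ioo.ae_eq_zero_of_integral_contDiff_smul_eq_zero ?_ key
    exact (hWc.mono Ioo_subset_Icc_self).locallyIntegrableOn measurableSet_Ioo
  have hz : ∀ t ∈ Icc 0 T, W t = 0 := by
    refine Measure.eqOn_Icc_of_ae_eq volume hT.ne ?_ hWc continuousOn_const
    rw [Measure.restrict_congr_set Ioo_ae_eq_Icc.symm]
    exact (ae_restrict_iff' measurableSet_Ioo).2 hae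
  intro t ht
  have := hz t ht
  simp only [hW] at this
  linarith

/-- If a symmetric function `F` of two times is differentiable in each variable, with derivative
`-N`, then `t ↦ F(t,t)` has the derivative `-2 N(t,t)`. No joint regularity of `F` is needed: the
increment of `F` along the diagonal is a sum of increments along a staircase. -/
theorem diagonal_increment {a b : ℝ} (hab : a < b) {F N : ℝ → ℝ → ℝ} {G : ℝ → ℝ}
    (hsymm : ∀ s ∈ Icc a b, ∀ t ∈ Icc a b, F s t = F t s)
    (hF : ∀ t ∈ Icc a b, ∀ s₁ ∈ Icc a b, ∀ s₂ ∈ Icc a b,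
      F s₂ t - F s₁ t = -∫ s in s₁..s₂, N s t)
    (hN : ∀ t ∈ Icc a b, IntervalIntegrable (fun s => N s t) volume a b)
    (hG : IntervalIntegrable G volume a b)
    (hle : ∀ᵐ s, s ∈ Ioc a b → ∀ t ∈ Icc a b, |N s t| ≤ G s)
    (hc : ∀ᵐ s, s ∈ Ioc a b → ContinuousOn (N s) (Icc a b)) :
    IntervalIntegrable (fun s => N s s) volume a b ∧
      F b b - F a a = -(2 * ∫ s in a..b, N s s) := by
  set h : ℕ → ℝ := fun n => (b - a) / ((n : ℝ) + 1) with hh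
  have hpos : ∀ n, 0 < h n := fun n => div_pos (by linarith) (by positivity)
  have hmul : ∀ n : ℕ, ((n : ℝ) + 1) * h n = b - a := fun n => by
    simp only [hh]; field_simp
  set p : ℕ → ℕ → ℝ := fun n i => a + i * h n with hp
  have hp0 : ∀ n, p n 0 = a := fun n => by simp [hp]
  have hpn : ∀ n, p n (n + 1) = b := fun n => by
    simp only [hp]; push_cast; rw [hmul]; ring
  have hpstep : ∀ n i, p n i ≤ p n (i + 1) := fun n i => by
    simp only [hp]; push_cast; nlinarith [hpos n]
  have hpmem : ∀ n i, i ≤ n + 1 → p n i ∈ Icc a b := fun n i hi => by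
    have h1 : (i : ℝ) ≤ n + 1 := by exact_mod_cast hi
    have h2 := mul_le_mul_of_nonneg_right h1 (hpos n).le
    rw [hmul] at h2
    have h3 : 0 ≤ (i : ℝ) * h n := mul_nonneg (Nat.cast_nonneg _) (hpos n).le
    simp only [hp]
    constructor <;> linarith
  -- `σ n s` is the index `i` with `s ∈ (p n i, p n (i + 1)]`.
  set σ : ℕ → ℝ → ℕ := fun n s => ⌈(s - a) / h n⌉₊ - 1 with hσ
  have hσeq : ∀ n i s, s ∈ Ioc (p n i) (p n (i + 1)) → σ n s = i := fun n i s hs => by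
    have h1 : ⌈(s - a) / h n⌉₊ = i + 1 := by
      rw [Nat.ceil_eq_iff (Nat.succ_ne_zero i), lt_div_iff₀ (hpos n), div_le_iff₀ (hpos n)]
      have h2 := hs.1
      have h3 := hs.2
      simp only [hp] at h2 h3
      push_cast at h3 ⊢
      constructor <;> linarith
    simp only [hσ, h1, Nat.add_sub_cancel]
  have hσmem : ∀ n s, s ∈ Ioc a b → σ n s ≤ n ∧ s ∈ Ioc (p n (σ n s)) (p n (σ n s + 1)) :=
    fun n s hs => by
      have h1 : 0 < (s - a) / h n := div_pos (by linarith [hs.1]) (hpos n)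
      have h2 : 0 < ⌈(s - a) / h n⌉₊ := Nat.ceil_pos.2 h1
      have h3 : σ n s + 1 = ⌈(s - a) / h n⌉₊ := Nat.succ_pred_eq_of_pos h2
      have h4 := (Nat.ceil_eq_iff (Nat.succ_ne_zero (σ n s))).1 h3.symm
      simp only [Nat.succ_eq_add_one, Nat.add_sub_cancel, lt_div_iff₀ (hpos n),
        div_le_iff₀ (hpos n)] at h4
      have h5 : ⌈(s - a) / h n⌉₊ ≤ n + 1 := by
        rw [Nat.ceil_le, div_le_iff₀ (hpos n)]
        push_cast
        rw [hmul]
        linarith [hs.2]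
      refine ⟨by omega, ?_, ?_⟩
      · simp only [hp]; linarith [h4.1]
      · simp only [hp]; linarith [h4.2]
  -- The staircase: on each mesh interval the second time is frozen at the right and left ends.
  set Φ : ℕ → ℝ → ℝ := fun n s => N s (p n (σ n s + 1)) + N s (p n (σ n s)) with hΦ
  have hsub : ∀ n i, i < n + 1 → uIoc (p n i) (p n (i + 1)) = Ioc (p n i) (p n (i + 1)) :=
    fun n i _ => uIoc_of_le (hpstep n i)
  have hNi : ∀ n i j, i < n + 1 → j ≤ n + 1 →
      IntervalIntegrable (fun s => N s (p n j)) volume (p n i) (p n (i + 1)) := fun n i j hi hj => by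
    refine (hN _ (hpmem n j hj)).mono_set ?_
    rw [uIcc_of_le (hpstep n i), uIcc_of_le hab.le]
    exact Icc_subset_Icc (hpmem n i hi.le).1 (hpmem n (i + 1) hi).2
  have hcongr : ∀ n i, i < n + 1 → EqOn (fun s => N s (p n (i + 1)) + N s (p n i)) (Φ n)
      (uIoc (p n i) (p n (i + 1))) := fun n i hi s hs => by
    rw [hsub n i hi] at hs
    simp only [hΦ, hσeq n i s hs]
  have hΦi : ∀ n i, i < n + 1 → IntervalIntegrable (Φ n) volume (p n i) (p n (i + 1)) :=
    fun n i hi => ((hNi n i (i + 1) hi hi).add (hNi n i i hi hi.le)).congr (hcongr n i hi)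
  have hΦab : ∀ n, IntervalIntegrable (Φ n) volume a b := fun n => by
    have := IntervalIntegrable.trans_iterate (hΦi n)
    rwa [hp0, hpn] at this
  have hΦint : ∀ n, ∫ s in a..b, Φ n s = -(F b b - F a a) := fun n => by
    have h1 := intervalIntegral.sum_integral_adjacent_intervals (hΦi n)
    rw [hp0, hpn] at h1
    rw [← h1]
    have h2 : ∀ i ∈ Finset.range (n + 1), ∫ s in p n i..p n (i + 1), Φ n s =
        -(F (p n (i + 1)) (p n (i + 1)) - F (p n i) (p n i)) := fun i hi => by
      have hi' := Finset.mem_range.1 hi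
      have m0 := hpmem n i hi'.le
      have m1 := hpmem n (i + 1) hi'
      rw [← intervalIntegral.integral_congr_ae (Eventually.of_forall (hcongr n i hi')),
        intervalIntegral.integral_add (hNi n i (i + 1) hi' hi') (hNi n i i hi' hi'.le)]
      have e1 := hF _ m1 _ m0 _ m1
      have e2 := hF _ m0 _ m0 _ m1
      have e3 := hsymm _ m0 _ m1
      linarith
    rw [Finset.sum_congr rfl h2, Finset.sum_neg_distrib,
      Finset.sum_range_sub fun i => F (p n i) (p n i), hp0, hpn]
  have hh0 : Tendsto h atTop (𝓝 0) := by
    have := (tendsto_one_div_add_atTop_nhds_zero_nat (𝕜 := ℝ)).const_mul (b - a)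
    simpa [hh, div_eq_mul_inv] using this
  have hlim : ∀ᵐ s, s ∈ uIoc a b → Tendsto (fun n => Φ n s) atTop (𝓝 (2 * N s s)) := by
    rw [uIoc_of_le hab.le]
    filter_upwards [hc] with s hs hmem
    have hcs := hs hmem s (Ioc_subset_Icc_self hmem)
    have hconv : ∀ q : ℕ → ℝ, (∀ n, q n ∈ Icc a b) → (∀ n, |q n - s| ≤ h n) →
        Tendsto (fun n => N s (q n)) atTop (𝓝 (N s s)) := fun q hq hqs => by
      refine hcs.tendsto.comp (tendsto_nhdsWithin_iff.2 ⟨?_, Eventually.of_forall hq⟩)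
      rw [tendsto_iff_norm_sub_tendsto_zero]
      exact squeeze_zero (fun _ => norm_nonneg _) hqs hh0
    rw [two_mul]
    have hstep : ∀ n i, p n (i + 1) = p n i + h n := fun n i => by
      simp only [hp]; push_cast; ring
    refine (hconv _ (fun n => hpmem n _ (by have := (hσmem n s hmem).1; omega)) fun n => ?_).add
      (hconv _ (fun n => hpmem n _ (by have := (hσmem n s hmem).1; omega)) fun n => ?_)
    all_goals
      have h1 := (hσmem n s hmem).2.1
      have h2 := (hσmem n s hmem).2.2
      have h3 := hstep n (σ n s)
      rw [abs_le]
      constructor <;> linarith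
  have hbound : ∀ n, ∀ᵐ s, s ∈ uIoc a b → ‖Φ n s‖ ≤ 2 * G s := fun n => by
    rw [uIoc_of_le hab.le]
    filter_upwards [hle] with s hs hmem
    have h1 := (hσmem n s hmem).1
    have := hs hmem _ (hpmem n (σ n s + 1) (by omega))
    have := hs hmem _ (hpmem n (σ n s) (by omega))
    calc ‖Φ n s‖ ≤ _ := abs_add_le _ _
      _ ≤ 2 * G s := by linarith
  have hdct := intervalIntegral.tendsto_integral_filter_of_dominated_convergence
    (fun s => 2 * G s) (Eventually.of_forall fun n => (hΦab n).def'.aestronglyMeasurable)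
    (Eventually.of_forall hbound) (hG.const_mul 2) hlim
  simp only [hΦint] at hdct
  have hval := tendsto_nhds_unique tendsto_const_nhds hdct
  rw [intervalIntegral.integral_const_mul] at hval
  refine ⟨?_, by linarith⟩
  have hmeas : AEStronglyMeasurable (fun s => 2 * N s s) (volume.restrict (uIoc a b)) :=
    aestronglyMeasurable_of_tendsto_ae atTop (fun n => (hΦab n).def'.aestronglyMeasurable)
      ((ae_restrict_iff' measurableSet_uIoc).2 hlim)
  have hmeas' : AEStronglyMeasurable (fun s => N s s) (volume.restrict (uIoc a b)) := by
    simpa using hmeas.const_mul (1 / 2)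
  refine hG.mono_fun' hmeas' ?_
  rw [EventuallyLE, ae_restrict_iff' measurableSet_uIoc, uIoc_of_le hab.le]
  filter_upwards [hle] with s hs hmem
  exact hs hmem s (Ioc_subset_Icc_self hmem)

/-! ### Mollified Leray–Hopf solutions -/

/-- The value of a mollification at a point is an `L²(𝕋³)` pairing. The test field is the kernel,
centred at the point and continued periodically from the period cell. -/
theorem mollify_apply_eq_scal {k : E3 → ℝ} (hk : IsKernel k) {u : E3 → E3} (hu : SpacePeriodic u)
    (hi : Integrable u μT) (x : E3) (i : Fin 3) :
    (mollify k u x) i = scal u fun z => k (wrap (z - x)) • e i := by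
  have h1 : (mollify k u x) i = ∫ y, k y * (u (x + y)) i := by
    have := (EuclideanSpace.proj (𝕜 := ℝ) i).integral_comp_comm (hk.integrable_smul hu hi x)
    simpa [mollify] using this.symm
  have h0 : ∀ y ∉ cell, k y * (u (x + y)) i = 0 := fun y hy => by
    rw [hk.eq_zero y (not_le.1 fun h => hy (ball_subset_cell (by simpa using h))), zero_mul]
  have h2 : ∫ y, k y * (u (x + y)) i = ∫ y, k (wrap (y + x - x)) * (u (y + x)) i ∂μT := by
    rw [← setIntegral_eq_integral_of_forall_compl_eq_zero h0, μT]
    refine setIntegral_congr_fun measurableSet_cell fun y hy => ?_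
    simp only [add_sub_cancel_right, wrap_eq_self hy, add_comm x y]
  have hp : SpacePeriodic fun z => k (wrap (z - x)) * (u z) i := fun z j => by
    simp only [hu z j, add_sub_right_comm, spacePeriodic_wrap (z - x) j]
  rw [h1, h2, hp.integral_add_right x, scal]
  congr 1
  funext z
  simp only [e, inner_smul_right, EuclideanSpace.inner_single_right]
  simp

/-- The mollification of a weakly continuous family is continuous at every point of space. -/
theorem continuousOn_mollify {k : E3 → ℝ} (hk : IsKernel k) {v : ℝ → E3 → E3} {I : Set ℝ}
    (hper : ∀ t ∈ I, SpacePeriodic (v t)) (hi : ∀ t ∈ I, Integrable (v t) μT)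
    (hv : ∀ g : E3 → E3, MemLp g 2 μT → ContinuousOn (fun t => scal (v t) g) I) (x : E3) :
    ContinuousOn (fun t => mollify k (v t) x) I := by
  have h : ∀ i, ContinuousOn (fun t => (mollify k (v t) x) i) I := fun i => by
    obtain ⟨C, -, hC⟩ := hk.exists_bound
    have hg : MemLp (fun z => k (wrap (z - x)) • e i) 2 μT := by
      refine MemLp.of_bound ?_ C (Eventually.of_forall fun z => ?_)
      · exact ((hk.smooth.continuous.measurable.comp
          (measurable_wrap.comp (measurable_id.sub_const x))).smul_const _).aestronglyMeasurable
      · simpa [norm_smul, norm_e] using hC _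
    exact (hv _ hg).congr fun t ht => mollify_apply_eq_scal hk (hper t ht) (hi t ht) x i
  exact (PiLp.continuous_toLp 2 _).comp_continuousOn (continuousOn_pi.2 h)

theorem norm_apply_e_le (A : E3 →L[ℝ] E3) (j : Fin 3) : ‖A (e j)‖ ≤ ‖A‖ := by
  have := A.le_opNorm (e j)
  rwa [norm_e, mul_one] at this

theorem norm_frob_le (A B : E3 →L[ℝ] E3) : ‖frob A B‖ ≤ 3 * (‖A‖ * ‖B‖) := by
  refine (norm_sum_le _ _).trans ?_
  have h : ∀ j, ‖inner ℝ (A (e j)) (B (e j))‖ ≤ ‖A‖ * ‖B‖ := fun j =>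
    (norm_inner_le_norm _ _).trans (mul_le_mul (norm_apply_e_le A j) (norm_apply_e_le B j)
      (norm_nonneg _) (norm_nonneg _))
  rw [Fin.sum_univ_three]
  linarith [h 0, h 1, h 2]

theorem scalMat_self_nonneg (A : E3 → E3 →L[ℝ] E3) : 0 ≤ scalMat A A :=
  integral_nonneg fun _ => Finset.sum_nonneg fun _ _ => real_inner_self_nonneg

theorem aestronglyMeasurable_frob {X : Type*} [MeasurableSpace X] {μ : Measure X}
    {A B : X → E3 →L[ℝ] E3} (hA : AEStronglyMeasurable A μ) (hB : AEStronglyMeasurable B μ) :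
    AEStronglyMeasurable (fun x => frob (A x) (B x)) μ := by
  simp only [frob, Fin.sum_univ_three]
  exact ((hA.apply_continuousLinearMap _).inner (hB.apply_continuousLinearMap _)).add
    ((hA.apply_continuousLinearMap _).inner (hB.apply_continuousLinearMap _)) |>.add
    ((hA.apply_continuousLinearMap _).inner (hB.apply_continuousLinearMap _))

/-- The quantity `ν (∇v(s), ∇w) + ((v(s) · ∇)v(s), w)`, which for a solenoidal field `w` is
`-d/ds (v(s), w)` along a solution. -/
def rate (ν : ℝ) (v : ℝ → E3 → E3) (Dv : ℝ → E3 → E3 →L[ℝ] E3) (w : E3 → E3) (s : ℝ) : ℝ :=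
  ν * scalMat (Dv s) (fun x => fderiv ℝ w x) + scal (fun x => Dv s x (v s x)) w

namespace IsLerayHopf

variable {ν T : ℝ} {v₀ : E3 → E3} {v : ℝ → E3 → E3} {Dv : ℝ → E3 → E3 →L[ℝ] E3}

theorem normSq_le (hv : IsLerayHopf ν T v₀ v Dv) (hν : 0 < ν) {t : ℝ} (ht : t ∈ Icc 0 T) :
    normSq (v t) ≤ normSq v₀ := by
  have h1 := hv.energy_le t ht
  have h2 : 0 ≤ ∫ τ in Ioo 0 t, scalMat (Dv τ) (Dv τ) :=
    integral_nonneg fun _ => scalMat_self_nonneg _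
  nlinarith [mul_nonneg hν.le h2]

theorem exists_integral_norm_le (hv : IsLerayHopf ν T v₀ v Dv) (hν : 0 < ν) :
    ∃ M, 0 ≤ M ∧ ∀ t ∈ Icc 0 T, ∫ x, ‖v t x‖ ∂μT ≤ M := by
  refine ⟨μT.real univ + normSq v₀, add_nonneg measureReal_nonneg (normSq_nonneg _),
    fun t ht => ?_⟩
  have hm := (hv.memH t ht).memLp
  have h1 : ∫ x, ‖v t x‖ ∂μT ≤ ∫ x, (1 + ‖v t x‖ ^ 2) ∂μT :=
    integral_mono (hv.memH t ht).integrable.norm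
      ((integrable_const 1).add (integrable_norm_sq hm)) fun x => by
        nlinarith [sq_nonneg (‖v t x‖ - 1), norm_nonneg (v t x)]
  rw [integral_add (integrable_const 1) (integrable_norm_sq hm)] at h1
  have h2 := hv.normSq_le hν ht
  simp only [integral_const, smul_eq_mul, mul_one] at h1
  exact h1.trans (add_le_add le_rfl h2)

theorem exists_mollify_le (hv : IsLerayHopf ν T v₀ v Dv) (hν : 0 < ν) {k : E3 → ℝ}
    (hk : IsKernel k) : ∃ C, 0 ≤ C ∧ ∀ t ∈ Icc 0 T, ∀ x, ‖mollify k (v t) x‖ ≤ C := by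
  obtain ⟨M, hM0, hM⟩ := hv.exists_integral_norm_le hν
  obtain ⟨K, hK0, hK⟩ := hk.exists_bound
  exact ⟨K * M, mul_nonneg hK0 hM0, fun t ht x =>
    (norm_mollify_le hk (hv.memH t ht).periodic (hv.memH t ht).integrable hK x).trans
      (mul_le_mul_of_nonneg_left (hM t ht) hK0)⟩

theorem exists_fderiv_mollify_le (hv : IsLerayHopf ν T v₀ v Dv) (hν : 0 < ν) {k : E3 → ℝ}
    (hk : IsKernel k) :
    ∃ C, 0 ≤ C ∧ ∀ t ∈ Icc 0 T, ∀ x, ‖fderiv ℝ (mollify k (v t)) x‖ ≤ C := by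
  choose C hC0 hC using fun j => hv.exists_mollify_le hν (hk.fderiv_apply (e j))
  refine ⟨∑ j, C j, Finset.sum_nonneg fun j _ => hC0 j, fun t ht x => ?_⟩
  refine ContinuousLinearMap.opNorm_le_bound _ (Finset.sum_nonneg fun j _ => hC0 j) fun h => ?_
  rw [clm_eq_sum _ h, Finset.sum_mul]
  refine (norm_sum_le _ _).trans (Finset.sum_le_sum fun j _ => ?_)
  rw [norm_smul, mul_comm, fderiv_mollify hk (hv.memH t ht).periodic (hv.memH t ht).integrable,
    norm_neg]
  exact mul_le_mul (hC j t ht x) (PiLp.norm_apply_le h j) (norm_nonneg _) (hC0 j)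

/-- The space-time cylinder measure. -/
abbrev cylinder (T : ℝ) : Measure (ℝ × E3) := (volume.restrict (Ioo 0 T)).prod μT

theorem memLp_velocity (hv : IsLerayHopf ν T v₀ v Dv) (hν : 0 < ν) :
    MemLp (fun p : ℝ × E3 => v p.1 p.2) 2 (cylinder T) := by
  rw [memLp_two_iff_integrable_sq_norm hv.measurable]
  have hm : AEStronglyMeasurable (fun p : ℝ × E3 => ‖v p.1 p.2‖ ^ 2) (cylinder T) :=
    hv.measurable.norm.pow 2
  rw [integrable_prod_iff hm]
  constructor
  · refine (ae_restrict_iff' measurableSet_Ioo).2 (Eventually.of_forall fun t ht => ?_)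
    exact integrable_norm_sq (hv.memH t (Ioo_subset_Icc_self ht)).memLp
  · refine Integrable.of_bound (C := normSq v₀) hm.norm.integral_prod_right' ?_
    refine (ae_restrict_iff' measurableSet_Ioo).2 (Eventually.of_forall fun t ht => ?_)
    simp only [norm_pow, norm_norm]
    rw [Real.norm_of_nonneg (integral_nonneg fun _ => by positivity)]
    exact hv.normSq_le hν (Ioo_subset_Icc_self ht)

theorem integrable_grad_sq (hv : IsLerayHopf ν T v₀ v Dv) :
    Integrable (fun p : ℝ × E3 => ‖Dv p.1 p.2‖ ^ 2) (cylinder T) :=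
  (memLp_two_iff_integrable_sq_norm hv.memLp_grad.1).1 hv.memLp_grad

theorem integrable_grad_mul (hv : IsLerayHopf ν T v₀ v Dv) (hν : 0 < ν) :
    Integrable (fun p : ℝ × E3 => ‖Dv p.1 p.2‖ * (1 + ‖v p.1 p.2‖)) (cylinder T) := by
  have h0 : MemLp (fun _ : ℝ × E3 => (1 : ℝ)) 2 (cylinder T) := memLp_const 1
  have h1 : MemLp (fun p : ℝ × E3 => 1 + ‖v p.1 p.2‖) 2 (cylinder T) :=
    h0.add (hv.memLp_velocity hν).norm
  have h2 : MemLp (fun p : ℝ × E3 => ‖Dv p.1 p.2‖) 2 (cylinder T) := hv.memLp_grad.norm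
  exact MemLp.integrable_mul h2 h1

theorem aestronglyMeasurable_convective (hv : IsLerayHopf ν T v₀ v Dv) :
    AEStronglyMeasurable (fun p : ℝ × E3 => Dv p.1 p.2 (v p.1 p.2)) (cylinder T) :=
  (ContinuousLinearMap.id ℝ (E3 →L[ℝ] E3)).aestronglyMeasurable_comp₂ hv.memLp_grad.1
    hv.measurable

theorem integrable_frob_fderiv (hv : IsLerayHopf ν T v₀ v Dv) (hν : 0 < ν) {w : E3 → E3}
    (hw : SpacePeriodic w) (hc : ContDiff ℝ ∞ w) :
    Integrable (fun p : ℝ × E3 => frob (Dv p.1 p.2) (fderiv ℝ w p.2)) (cylinder T) := by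
  have hDc : Continuous (fderiv ℝ w) := hc.continuous_fderiv (by simp)
  obtain ⟨C, hC0, hC⟩ := hw.fderiv.bounded_of_continuous hDc
  have hm := aestronglyMeasurable_frob hv.memLp_grad.1
    (hDc.comp continuous_snd).aestronglyMeasurable
  refine ((hv.integrable_grad_mul hν).const_mul (3 * C)).mono' hm
    (Eventually.of_forall fun p => (norm_frob_le _ _).trans ?_)
  have h1 : ‖Dv p.1 p.2‖ * ‖fderiv ℝ w p.2‖ ≤ ‖Dv p.1 p.2‖ * C :=
    mul_le_mul_of_nonneg_left (hC _) (norm_nonneg _)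
  have h2 : 0 ≤ C * (‖Dv p.1 p.2‖ * ‖v p.1 p.2‖) := by positivity
  linarith

theorem integrable_convective (hv : IsLerayHopf ν T v₀ v Dv) (hν : 0 < ν) {w : E3 → E3}
    (hw : SpacePeriodic w) (hc : ContDiff ℝ ∞ w) :
    Integrable (fun p : ℝ × E3 => inner ℝ (Dv p.1 p.2 (v p.1 p.2)) (w p.2)) (cylinder T) := by
  obtain ⟨C, hC0, hC⟩ := hw.bounded_of_continuous hc.continuous
  refine ((hv.integrable_grad_mul hν).const_mul C).mono'
    (hv.aestronglyMeasurable_convective.inner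
      (hc.continuous.comp continuous_snd).aestronglyMeasurable)
    (Eventually.of_forall fun p => (norm_inner_le_norm _ _).trans ?_)
  have h1 : ‖Dv p.1 p.2 (v p.1 p.2)‖ * ‖w p.2‖ ≤ (‖Dv p.1 p.2‖ * ‖v p.1 p.2‖) * C := by
    gcongr
    · exact ContinuousLinearMap.le_opNorm _ _
    · exact hC _
  have h2 : 0 ≤ C * ‖Dv p.1 p.2‖ := by positivity
  nlinarith

theorem integrableOn_rate (hv : IsLerayHopf ν T v₀ v Dv) (hν : 0 < ν) {w : E3 → E3}
    (hw : SpacePeriodic w) (hc : ContDiff ℝ ∞ w) :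
    IntegrableOn (rate ν v Dv w) (Ioo 0 T) :=
  ((hv.integrable_frob_fderiv hν hw hc).integral_prod_left.const_mul ν).add
    (hv.integrable_convective hν hw hc).integral_prod_left

/-- The weak form of the equations, tested with a solenoidal field which does not depend on
time. -/
theorem scal_eq_sub_integral (hv : IsLerayHopf ν T v₀ v Dv) (hν : 0 < ν) (hT : 0 < T) {w : E3 → E3}
    (hw : SpacePeriodic w) (hc : ContDiff ℝ ∞ w) (hdiv : ∀ x, divergence w x = 0) :
    ∀ t ∈ Icc 0 T, scal (v t) w = scal v₀ w - ∫ s in (0 : ℝ)..t, rate ν v Dv w s := by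
  refine eq_sub_integral_of_weak_deriv hT
    (hv.weak_cont w (hw.memLp_of_continuous hc.continuous 2)) (hv.integrableOn_rate hν hw hc)
    fun χ hχ hχ0 => ?_
  have hwd : Differentiable ℝ w := hc.differentiable (by simp)
  have hfd : ∀ t x, fderiv ℝ (fun x => χ t • w x) x = χ t • fderiv ℝ w x := fun t x =>
    fderiv_fun_const_smul (hwd x) (χ t)
  have htest : IsTestFunction T fun t x => χ t • w x :=
    { smooth := (hχ.comp contDiff_fst).smul (hc.comp contDiff_snd)
      periodic := fun t x i => by simp only [hw x i]
      div_free := fun t x => by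
        have := hdiv x
        simp only [divergence] at this
        simp only [divergence, hfd, smul_apply, PiLp.smul_apply, smul_eq_mul, ← Finset.mul_sum,
          this, mul_zero]
      vanish := by
        obtain ⟨T', hT', h0⟩ := hχ0
        exact ⟨T', hT', fun t ht x => by simp [h0 t ht]⟩ }
  have hwf := hv.weak_form _ htest
  have h1 : ∀ (u : E3 → E3) (c : ℝ), scal u (fun x => c • w x) = c * scal u w := fun u c => by
    simp only [scal, inner_smul_right, integral_const_mul]
  have h2 : ∀ (A : E3 → E3 →L[ℝ] E3) (c : ℝ), scalMat A (fun x => c • fderiv ℝ w x) =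
      c * scalMat A (fun x => fderiv ℝ w x) := fun A c => by
    simp only [scalMat, frob, smul_apply, inner_smul_right, ← Finset.mul_sum,
      integral_const_mul]
  have h3 : ∀ t x, deriv (fun s => χ s • w x) t = deriv χ t • w x := fun t x =>
    deriv_smul_const (hχ.differentiable (by simp) t) (w x)
  simp only [h3, hfd, h1, h2] at hwf
  rw [← hwf]
  congr 1
  funext t
  simp only [rate]
  ring

end IsLerayHopf

theorem scalMat_eq_sum {A B : E3 → E3 →L[ℝ] E3} (hA : MemLp A 2 μT) (hB : MemLp B 2 μT) :
    scalMat A B = ∑ j, scal (fun x => A x (e j)) fun x => B x (e j) := by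
  have h : ∀ {D : E3 → E3 →L[ℝ] E3}, MemLp D 2 μT → ∀ j, MemLp (fun x => D x (e j)) 2 μT :=
    fun hD j => hD.mono (hD.1.apply_continuousLinearMap _)
      (Eventually.of_forall fun x => norm_apply_e_le _ j)
  simp only [scalMat, frob, scal]
  exact integral_finsetSum _ fun j _ => integrable_inner (h hA j) (h hB j)

theorem ae_Ioc_of_ae_Ioo {P : ℝ → Prop} {a b c T : ℝ} (hc : c ≤ a) (hb : b ≤ T)
    (h : ∀ᵐ s ∂(volume.restrict (Ioo c T)), P s) : ∀ᵐ s, s ∈ Ioc a b → P s := by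
  have hne : ∀ᵐ s : ℝ, s ≠ T := by simp [ae_iff]
  filter_upwards [(ae_restrict_iff' measurableSet_Ioo).1 h, hne] with s hs hsT hmem
  exact hs ⟨hc.trans_lt hmem.1, lt_of_le_of_ne (hmem.2.trans hb) hsT⟩

theorem intervalIntegrable_of_integrableOn_Ioo {f : ℝ → ℝ} {a b c T : ℝ} (hc : c ≤ a) (hab : a ≤ b)
    (hb : b ≤ T) (h : IntegrableOn f (Ioo c T)) : IntervalIntegrable f volume a b :=
  (intervalIntegrable_iff_integrableOn_Ioo_of_le hab).2 (h.mono_set (Ioo_subset_Ioo hc hb))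

namespace IsLerayHopf

variable {ν T : ℝ} {v₀ : E3 → E3} {v : ℝ → E3 → E3} {Dv : ℝ → E3 → E3 →L[ℝ] E3} {k : E3 → ℝ}

/-- The energy balance of the mollified solution. -/
theorem mollified_energy (hv : IsLerayHopf ν T v₀ v Dv) (hν : 0 < ν) (hT : 0 < T)
    (hk : IsKernel k) (heven : ∀ y, k (-y) = k y) {a b : ℝ} (ha : 0 ≤ a) (hab : a < b)
    (hb : b ≤ T) :
    IntervalIntegrable (fun s => rate ν v Dv (mollify k (v s)) s) volume a b ∧
      scal (v b) (mollify k (v b)) - scal (v a) (mollify k (v a)) =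
        -(2 * ∫ s in a..b, rate ν v Dv (mollify k (v s)) s) := by
  have hsub : Icc a b ⊆ Icc 0 T := Icc_subset_Icc ha hb
  have hper : ∀ t ∈ Icc a b, SpacePeriodic (v t) := fun t ht => (hv.memH t (hsub ht)).periodic
  have hint : ∀ t ∈ Icc a b, Integrable (v t) μT := fun t ht => (hv.memH t (hsub ht)).integrable
  have hmem : ∀ t ∈ Icc a b, MemLp (v t) 2 μT := fun t ht => (hv.memH t (hsub ht)).memLp
  have hmper : ∀ t ∈ Icc a b, SpacePeriodic (mollify k (v t)) := fun t ht => (hper t ht).mollify k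
  have hmc : ∀ t ∈ Icc a b, ContDiff ℝ ∞ (mollify k (v t)) := fun t ht =>
    contDiff_mollify hk (hper t ht) (hint t ht)
  obtain ⟨C, hC0, hC⟩ := hv.exists_mollify_le hν hk
  obtain ⟨C', hC'0, hC'⟩ := hv.exists_fderiv_mollify_le hν hk
  have hcont : ∀ {l : E3 → ℝ}, IsKernel l → ∀ x,
      ContinuousOn (fun t => mollify l (v t) x) (Icc a b) := fun hl x =>
    continuousOn_mollify hl hper hint (fun g hg => (hv.weak_cont g hg).mono hsub) x
  -- The properties of almost every time slice.
  have hslice : ∀ᵐ s, s ∈ Ioc a b → Integrable (fun x => ‖Dv s x‖ * (1 + ‖v s x‖)) μT ∧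
      AEStronglyMeasurable (Dv s) μT ∧ AEStronglyMeasurable (fun x => Dv s x (v s x)) μT := by
    refine ae_Ioc_of_ae_Ioo ha hb ?_
    filter_upwards [(hv.integrable_grad_mul hν).prod_right_ae, hv.memLp_grad.1.prodMk_left,
      hv.aestronglyMeasurable_convective.prodMk_left] with s h1 h2 h3
    exact ⟨h1, h2, h3⟩
  have hb1 : ∀ s, ∀ t ∈ Icc a b, ∀ x, ‖frob (Dv s x) (fderiv ℝ (mollify k (v t)) x)‖ ≤
      3 * C' * (‖Dv s x‖ * (1 + ‖v s x‖)) := fun s t ht x => by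
    refine (norm_frob_le _ _).trans ?_
    have h1 := mul_le_mul_of_nonneg_left (hC' t (hsub ht) x) (norm_nonneg (Dv s x))
    have h2 : 0 ≤ C' * (‖Dv s x‖ * ‖v s x‖) := by positivity
    linarith
  have hb2 : ∀ s, ∀ t ∈ Icc a b, ∀ x, ‖inner ℝ (Dv s x (v s x)) (mollify k (v t) x)‖ ≤
      C * (‖Dv s x‖ * (1 + ‖v s x‖)) := fun s t ht x => by
    refine (norm_inner_le_norm _ _).trans ?_
    have h1 := mul_le_mul ((Dv s x).le_opNorm (v s x)) (hC t (hsub ht) x) (norm_nonneg _)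
      (by positivity)
    have h2 : 0 ≤ C * ‖Dv s x‖ := by positivity
    linarith
  refine diagonal_increment (G := fun s => (ν * (3 * C') + C) *
      ∫ x, ‖Dv s x‖ * (1 + ‖v s x‖) ∂μT) (F := fun s t => scal (v s) (mollify k (v t)))
    (N := fun s t => rate ν v Dv (mollify k (v t)) s) hab
    (fun s hs t ht => scal_mollify_comm hk heven (hper s hs) (hmem s hs) (hper t ht) (hmem t ht))
    (fun t ht s₁ hs₁ s₂ hs₂ => ?_) (fun t ht => ?_) ?_ ?_ ?_
  · obtain ⟨w, hw⟩ := (hv.memH t (hsub ht)).exists_limit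
    have hform := hv.scal_eq_sub_integral hν hT (hmper t ht) (hmc t ht)
      (hw.divergence_mollify hk)
    have hi : ∀ s ∈ Icc 0 T,
        IntervalIntegrable (rate ν v Dv (mollify k (v t))) volume 0 s := fun s hs =>
      intervalIntegrable_of_integrableOn_Ioo le_rfl hs.1 hs.2
        (hv.integrableOn_rate hν (hmper t ht) (hmc t ht))
    rw [hform s₁ (hsub hs₁), hform s₂ (hsub hs₂),
      ← intervalIntegral.integral_interval_sub_left (hi s₂ (hsub hs₂)) (hi s₁ (hsub hs₁))]
    ring
  · exact intervalIntegrable_of_integrableOn_Ioo ha hab.le hb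
      (hv.integrableOn_rate hν (hmper t ht) (hmc t ht))
  · exact intervalIntegrable_of_integrableOn_Ioo ha hab.le hb
      ((hv.integrable_grad_mul hν).integral_prod_left.const_mul _)
  · filter_upwards [hslice] with s hs hmem t ht
    obtain ⟨hi, -, -⟩ := hs hmem
    have h1 := norm_integral_le_of_norm_le (hi.const_mul (3 * C'))
      (Eventually.of_forall (hb1 s t ht))
    have h2 := norm_integral_le_of_norm_le (hi.const_mul C) (Eventually.of_forall (hb2 s t ht))
    rw [integral_const_mul] at h1 h2
    calc |rate ν v Dv (mollify k (v t)) s| ≤ _ := abs_add_le _ _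
      _ ≤ ν * (3 * C' * ∫ x, ‖Dv s x‖ * (1 + ‖v s x‖) ∂μT) +
          C * ∫ x, ‖Dv s x‖ * (1 + ‖v s x‖) ∂μT := by
        rw [abs_mul, abs_of_pos hν]
        exact add_le_add (mul_le_mul_of_nonneg_left h1 hν.le) h2
      _ = _ := by ring
  · filter_upwards [hslice] with s hs hmem
    obtain ⟨hi, hm1, hm2⟩ := hs hmem
    have hc1 : ContinuousOn
        (fun t => scalMat (Dv s) fun x => fderiv ℝ (mollify k (v t)) x) (Icc a b) := by
      refine continuousOn_of_dominated (fun t ht => aestronglyMeasurable_frob hm1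
        ((hmc t ht).continuous_fderiv (by simp)).aestronglyMeasurable)
        (fun t ht => Eventually.of_forall (hb1 s t ht)) (hi.const_mul _)
        (Eventually.of_forall fun x => ?_)
      refine continuousOn_finsetSum _ fun j _ => continuousOn_const.inner ?_
      exact (hcont (hk.fderiv_apply (e j)) x).neg.congr fun t ht =>
        fderiv_mollify hk (hper t ht) (hint t ht) x (e j)
    have hc2 : ContinuousOn
        (fun t => scal (fun x => Dv s x (v s x)) (mollify k (v t))) (Icc a b) :=
      continuousOn_of_dominated (fun t ht => hm2.inner (hmc t ht).continuous.aestronglyMeasurable)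
        (fun t ht => Eventually.of_forall (hb2 s t ht)) (hi.const_mul _)
        (Eventually.of_forall fun x => continuousOn_const.inner (hcont hk x))
    exact (continuousOn_const.mul hc1).add hc2

end IsLerayHopf

/-! ### Removing the mollification -/

/-- The bound of the energy flux which is uniform in the scale `r`. The exponents balance because
`(1 + α) / 2 + (1 - α) / 2 = 1`. -/
theorem rpow_mul_min_le {α f D E r : ℝ} (hα : α ∈ Ioo (0 : ℝ) 1) (hf : 0 ≤ f) (hD : 0 ≤ D)
    (hE : 0 ≤ E) (hr : 0 < r) :
    r ^ (α - 1) * f * min E (r ^ 2 * D) ≤ (E + 1) * (f ^ (2 / (1 + α)) + D) := by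
  obtain ⟨hα0, hα1⟩ := hα
  set g := √D with hg
  have hg0 : 0 ≤ g := Real.sqrt_nonneg D
  have hgD : g ^ 2 = D := Real.sq_sqrt hD
  have hfg : f * g ^ (1 - α) ≤ f ^ (2 / (1 + α)) + D := by
    have hpq : (2 / (1 + α)).HolderConjugate (2 / (1 - α)) := by
      rw [Real.holderConjugate_iff]
      have h1 : 0 < 1 - α := by linarith
      have h2 : 0 < 1 + α := by linarith
      refine ⟨by rw [lt_div_iff₀ h2]; linarith, ?_⟩
      field_simp
      ring
    have hy := Real.young_inequality_of_nonneg hf (Real.rpow_nonneg hg0 (1 - α)) hpq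
    have hgp : (g ^ (1 - α)) ^ (2 / (1 - α)) = D := by
      have h1 : 1 - α ≠ 0 := by linarith
      rw [← Real.rpow_mul hg0, mul_div_cancel₀ _ h1, ← hgD, Real.rpow_two]
    rw [hgp] at hy
    refine hy.trans (add_le_add (div_le_self (Real.rpow_nonneg hf _) hpq.lt.le)
      (div_le_self hD hpq.symm.lt.le))
  have hfg0 : 0 ≤ f * g ^ (1 - α) := mul_nonneg hf (Real.rpow_nonneg hg0 _)
  have hr0 : 0 ≤ r ^ (α - 1) := Real.rpow_nonneg hr.le _
  have hmain : r ^ (α - 1) * min E (r ^ 2 * D) ≤ (E + 1) * g ^ (1 - α) := by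
    rcases le_or_gt 1 (r * g) with h | h
    · -- The energy bound of the translation differences is used.
      have h1 : r⁻¹ ≤ g := by rwa [inv_le_iff_one_le_mul₀' hr]
      have h2 : r ^ (α - 1) ≤ g ^ (1 - α) := by
        rw [← neg_sub, Real.rpow_neg hr.le, ← Real.inv_rpow hr.le]
        exact Real.rpow_le_rpow (inv_nonneg.2 hr.le) h1 (by linarith)
      calc _ ≤ g ^ (1 - α) * E := mul_le_mul h2 (min_le_left _ _)
            (le_min hE (by positivity)) (Real.rpow_nonneg hg0 _)
        _ ≤ _ := by nlinarith [Real.rpow_nonneg hg0 (1 - α)]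
    · -- The gradient bound of the translation differences is used.
      have h1 : r ^ (α - 1) * (r ^ 2 * D) = (r * g) ^ (1 + α) * g ^ (1 - α) := by
        rcases hg0.eq_or_lt with h0 | h0
        · rw [← hgD, ← h0, mul_zero, Real.zero_rpow (by linarith)]
          simp
        · rw [Real.mul_rpow hr.le hg0, mul_assoc, ← Real.rpow_add h0, ← hgD, ← mul_assoc,
            ← Real.rpow_two r, ← Real.rpow_add hr, ← Real.rpow_two g]
          ring_nf
      have h2 : (r * g) ^ (1 + α) ≤ 1 :=
        Real.rpow_le_one (mul_nonneg hr.le hg0) h.le (by linarith)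
      calc _ ≤ r ^ (α - 1) * (r ^ 2 * D) := mul_le_mul_of_nonneg_left (min_le_right _ _) hr0
        _ = (r * g) ^ (1 + α) * g ^ (1 - α) := h1
        _ ≤ 1 * g ^ (1 - α) := mul_le_mul_of_nonneg_right h2 (Real.rpow_nonneg hg0 _)
        _ ≤ _ := by nlinarith [Real.rpow_nonneg hg0 (1 - α)]
  calc _ = f * (r ^ (α - 1) * min E (r ^ 2 * D)) := by ring
    _ ≤ f * ((E + 1) * g ^ (1 - α)) := mul_le_mul_of_nonneg_left hmain hf
    _ = (E + 1) * (f * g ^ (1 - α)) := by ring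
    _ ≤ _ := mul_le_mul_of_nonneg_left hfg (by linarith)

theorem continuous_of_holder {u : E3 → E3} {α f : ℝ} (hα : 0 < α)
    (hH : ∀ x y, ‖u x - u y‖ ≤ f * ‖x - y‖ ^ α) : Continuous u := by
  rw [continuous_iff_continuousAt]
  intro x
  rw [ContinuousAt, tendsto_iff_norm_sub_tendsto_zero]
  have h : Tendsto (fun y : E3 => f * ‖y - x‖ ^ α) (𝓝 x) (𝓝 (f * ‖x - x‖ ^ α)) := by
    refine Continuous.tendsto (continuous_const.mul ?_) x
    exact (continuous_id.sub continuous_const).norm.rpow_const fun _ => Or.inr hα.le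
  rw [sub_self, norm_zero, Real.zero_rpow hα.ne', mul_zero] at h
  exact squeeze_zero (fun _ => norm_nonneg _) (fun y => hH y x) h

section Slice

variable {k : E3 → ℝ} {r : ℝ} {u : E3 → E3} {A : E3 → E3 →L[ℝ] E3}

theorem IsMollifier.flux_le (hk : IsMollifier k r) (hr : 0 < r) {C : ℝ}
    (hC : ∫ y, ‖fderiv ℝ k y‖ ≤ C / r) (hu : MemV u A) {α f : ℝ} (hα : α ∈ Ioo (0 : ℝ) 1)
    (hf : 0 ≤ f) (hH : ∀ x y, ‖u x - u y‖ ≤ f * ‖x - y‖ ^ α) :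
    |scal (fun x => A x (u x)) (mollify k u)| ≤
      C * (r ^ (α - 1) * f * min (4 * normSq u) (r ^ 2 * ∫ x, ‖A x‖ ^ 2 ∂μT)) := by
  have hD : 0 ≤ ∫ x, ‖A x‖ ^ 2 ∂μT := integral_nonneg fun _ => by positivity
  have h := hk.abs_flux_le hu (continuous_of_holder hα.1 hH) hα.1.le hf hH
    (S := min (4 * normSq u) (r ^ 2 * ∫ x, ‖A x‖ ^ 2 ∂μT)) fun y hy =>
      le_min (TorusNS.shiftSq_le hu.periodic hu.memLp y) ((hu.shiftSq_le y).trans (by gcongr))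
  refine h.trans ((mul_le_mul_of_nonneg_right hC ?_).trans_eq ?_)
  · have := normSq_nonneg u
    positivity
  · rw [Real.rpow_sub_one hr.ne']
    field_simp

theorem MemV.memLp_column (hu : MemV u A) (j : Fin 3) : MemLp (fun x => A x (e j)) 2 μT :=
  hu.memLp_grad.mono (hu.memLp_grad.1.apply_continuousLinearMap _)
    (Eventually.of_forall fun _ => norm_apply_e_le _ j)

theorem MemV.periodic_column (hu : MemV u A) (j : Fin 3) : SpacePeriodic fun x => A x (e j) :=
  fun x i => by simp only [hu.periodic_grad x i]

theorem MemV.scalMat_self_eq (hu : MemV u A) :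
    scalMat A A = ∑ j, normSq fun x => A x (e j) := by
  rw [scalMat_eq_sum hu.memLp_grad hu.memLp_grad]
  simp only [scal_self]

theorem MemV.scalMat_mollify_eq (hu : MemV u A) (hk : IsKernel k) :
    scalMat A (fun x => fderiv ℝ (mollify k u) x) =
      ∑ j, scal (fun x => A x (e j)) (mollify k fun x => A x (e j)) := by
  have hc := contDiff_mollify hk hu.periodic (hu.memLp.integrable (by norm_num))
  rw [scalMat_eq_sum hu.memLp_grad ((hu.periodic.mollify k).fderiv.memLp_of_continuous
    (hc.continuous_fderiv (by simp)) 2)]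
  simp only [hu.fderiv_mollify hk]

theorem MemV.abs_scalMat_mollify_le (hu : MemV u A) (hk : IsMollifier k r) :
    |scalMat A (fun x => fderiv ℝ (mollify k u) x)| ≤ scalMat A A := by
  rw [hu.scalMat_mollify_eq hk.toIsKernel, hu.scalMat_self_eq]
  refine (Finset.abs_sum_le_sum_abs _ _).trans (Finset.sum_le_sum fun j _ => abs_le.2 ⟨?_, ?_⟩)
  · exact hk.neg_normSq_le_scal_mollify_self (hu.periodic_column j) (hu.memLp_column j)
  · exact hk.scal_mollify_self_le (hu.periodic_column j) (hu.memLp_column j)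

theorem MemV.tendsto_scalMat_mollify (hu : MemV u A) {k : ℕ → E3 → ℝ} {r : ℕ → ℝ}
    (hk : ∀ n, IsMollifier (k n) (r n)) (hr : Tendsto r atTop (𝓝 0)) :
    Tendsto (fun n => scalMat A (fun x => fderiv ℝ (mollify (k n) u) x)) atTop
      (𝓝 (scalMat A A)) := by
  rw [hu.scalMat_self_eq]
  simp only [fun n => hu.scalMat_mollify_eq (hk n).toIsKernel]
  exact tendsto_finsetSum _ fun j _ => tendsto_scal_mollify hk hr (hu.periodic_column j)
    (hu.memLp_column j) (hu.isSmoothLimit_grad j)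

end Slice

namespace IsLerayHopf

variable {ν T : ℝ} {v₀ : E3 → E3} {v : ℝ → E3 → E3} {Dv : ℝ → E3 → E3 →L[ℝ] E3}

theorem integrableOn_dissipation (hv : IsLerayHopf ν T v₀ v Dv) :
    IntegrableOn (fun s => scalMat (Dv s) (Dv s)) (Ioo 0 T) := by
  have h : Integrable (fun p : ℝ × E3 => frob (Dv p.1 p.2) (Dv p.1 p.2)) (cylinder T) := by
    refine (hv.integrable_grad_sq.const_mul 3).mono'
      (aestronglyMeasurable_frob hv.memLp_grad.1 hv.memLp_grad.1)
      (Eventually.of_forall fun p => (norm_frob_le _ _).trans_eq ?_)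
    rw [sq]
  exact h.integral_prod_left

/-- The energy equality between two positive times. -/
theorem energy_increment (hv : IsLerayHopf ν T v₀ v Dv) (hν : 0 < ν) (hT : 0 < T) {α a b : ℝ}
    (hα : α ∈ Ioo (0 : ℝ) 1) (ha : 0 < a) (hab : a < b) (hb : b ≤ T)
    (hH : MemLpHolder (2 / (1 + α)) α a T v) :
    normSq (v b) - normSq (v a) = -(2 * ∫ s in a..b, ν * scalMat (Dv s) (Dv s)) := by
  obtain ⟨C, hC0, hC⟩ := exists_isMollifier
  set r : ℕ → ℝ := fun n => 1 / ((n : ℝ) + 1) with hr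
  have hr0 : ∀ n, 0 < r n := fun n => by positivity
  have hr1 : ∀ n, r n ≤ 1 := fun n => by
    simp only [hr]
    rw [div_le_one (by positivity)]
    linarith [Nat.cast_nonneg (α := ℝ) n]
  have hrlim : Tendsto r atTop (𝓝 0) := tendsto_one_div_add_atTop_nhds_zero_nat
  choose k hk hkC using fun n => hC (r n) (hr0 n) (hr1 n)
  obtain ⟨f, hf0, hfH, hfi⟩ := hH
  set E := 4 * normSq v₀ with hE
  have hE0 : 0 ≤ E := mul_nonneg (by norm_num) (normSq_nonneg _)
  have hbal := fun n => hv.mollified_energy hν hT (hk n).toIsKernel (hk n).even ha.le hab hb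
  -- The properties of almost every time slice.
  have hslice : ∀ᵐ s, s ∈ Ioc a b → MemV (v s) (Dv s) ∧ s ∈ Icc 0 T ∧
      ∀ x y : E3, ‖v s x - v s y‖ ≤ f s * ‖x - y‖ ^ α := by
    filter_upwards [ae_Ioc_of_ae_Ioo ha.le hb hv.memV, ae_Ioc_of_ae_Ioo le_rfl hb hfH]
      with s h1 h2 hmem
    exact ⟨h1 hmem, ⟨ha.le.trans hmem.1.le, hmem.2.trans hb⟩, h2 hmem⟩
  have hflux : ∀ᵐ s, s ∈ Ioc a b → ∀ n,
      |scal (fun x => Dv s x (v s x)) (mollify (k n) (v s))| ≤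
        C * (r n ^ (α - 1) * f s * min E (r n ^ 2 * ∫ x, ‖Dv s x‖ ^ 2 ∂μT)) := by
    filter_upwards [hslice] with s hs hmem n
    obtain ⟨hV, hsT, hHs⟩ := hs hmem
    refine ((hk n).flux_le (hr0 n) (hkC n) hV hα (hf0 s) hHs).trans ?_
    refine mul_le_mul_of_nonneg_left (mul_le_mul_of_nonneg_left (min_le_min_right _ ?_)
      (mul_nonneg (Real.rpow_nonneg (hr0 n).le _) (hf0 s))) hC0
    exact mul_le_mul_of_nonneg_left (hv.normSq_le hν hsT) (by norm_num)
  -- A majorant of the integrands which does not depend on the scale.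
  set G : ℝ → ℝ := fun s => ν * scalMat (Dv s) (Dv s) +
    C * ((E + 1) * (f s ^ (2 / (1 + α)) + ∫ x, ‖Dv s x‖ ^ 2 ∂μT)) with hG
  have hGi : IntervalIntegrable G volume a b := by
    have h1 := intervalIntegrable_of_integrableOn_Ioo ha.le hab.le hb
      (hv.integrableOn_dissipation.const_mul ν)
    have h2 := intervalIntegrable_of_integrableOn_Ioo le_rfl hab.le hb hfi
    have h3 := intervalIntegrable_of_integrableOn_Ioo ha.le hab.le hb
      hv.integrable_grad_sq.integral_prod_left
    exact h1.add (((h2.add h3).const_mul (E + 1)).const_mul C)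
  have hbound : ∀ n, ∀ᵐ s, s ∈ uIoc a b → ‖rate ν v Dv (mollify (k n) (v s)) s‖ ≤ G s :=
    fun n => by
      rw [uIoc_of_le hab.le]
      filter_upwards [hslice, hflux] with s hs hfs hmem
      obtain ⟨hV, hsT, hHs⟩ := hs hmem
      refine (abs_add_le _ _).trans (add_le_add ?_ ((hfs hmem n).trans ?_))
      · rw [abs_mul, abs_of_pos hν]
        exact mul_le_mul_of_nonneg_left (hV.abs_scalMat_mollify_le (hk n)) hν.le
      · exact mul_le_mul_of_nonneg_left (rpow_mul_min_le hα (hf0 s)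
          (integral_nonneg fun _ => by positivity) hE0 (hr0 n)) hC0
  have hlim : ∀ᵐ s, s ∈ uIoc a b → Tendsto (fun n => rate ν v Dv (mollify (k n) (v s)) s) atTop
      (𝓝 (ν * scalMat (Dv s) (Dv s))) := by
    rw [uIoc_of_le hab.le]
    filter_upwards [hslice, hflux] with s hs hfs hmem
    obtain ⟨hV, hsT, hHs⟩ := hs hmem
    have h1 := (hV.tendsto_scalMat_mollify hk hrlim).const_mul ν
    have h2 : Tendsto (fun n => scal (fun x => Dv s x (v s x)) (mollify (k n) (v s))) atTop
        (𝓝 0) := by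
      have h3 := hrlim.const_mul (C * (f s * ∫ x, ‖Dv s x‖ ^ 2 ∂μT))
      rw [mul_zero] at h3
      refine squeeze_zero_norm (fun n => (hfs hmem n).trans ?_) h3
      have hD : 0 ≤ ∫ x, ‖Dv s x‖ ^ 2 ∂μT := integral_nonneg fun _ => by positivity
      have hp : r n ^ (α - 1) * r n ^ 2 ≤ r n := by
        rw [← Real.rpow_two, ← Real.rpow_add (hr0 n)]
        calc r n ^ (α - 1 + 2) ≤ r n ^ (1 : ℝ) :=
              Real.rpow_le_rpow_of_exponent_ge (hr0 n) (hr1 n) (by linarith [hα.1])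
          _ = r n := Real.rpow_one _
      calc C * (r n ^ (α - 1) * f s * min E (r n ^ 2 * ∫ x, ‖Dv s x‖ ^ 2 ∂μT))
          ≤ C * (r n ^ (α - 1) * f s * (r n ^ 2 * ∫ x, ‖Dv s x‖ ^ 2 ∂μT)) :=
            mul_le_mul_of_nonneg_left (mul_le_mul_of_nonneg_left (min_le_right _ _)
              (mul_nonneg (Real.rpow_nonneg (hr0 n).le _) (hf0 s))) hC0
        _ = C * (f s * ∫ x, ‖Dv s x‖ ^ 2 ∂μT) * (r n ^ (α - 1) * r n ^ 2) := by ring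
        _ ≤ _ := mul_le_mul_of_nonneg_left hp (mul_nonneg hC0 (mul_nonneg (hf0 s) hD))
    simpa only [rate, add_zero] using h1.add h2
  have hdct := intervalIntegral.tendsto_integral_filter_of_dominated_convergence G
    (Eventually.of_forall fun n => (hbal n).1.def'.aestronglyMeasurable)
    (Eventually.of_forall hbound) hGi hlim
  have hend : ∀ t ∈ Icc 0 T,
      Tendsto (fun n => scal (v t) (mollify (k n) (v t))) atTop (𝓝 (normSq (v t))) := fun t ht =>
    tendsto_scal_mollify hk hrlim (hv.memH t ht).periodic (hv.memH t ht).memLp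
      (hv.memH t ht).isSmoothLimit
  have hL := (hend b ⟨(ha.trans hab).le, hb⟩).sub (hend a ⟨ha.le, hab.le.trans hb⟩)
  have hR := (hdct.const_mul 2).neg
  simp only [fun n => (hbal n).2] at hL
  exact tendsto_nhds_unique hL hR

/-- As `t → 0⁺` the pairings of `v(t)` with a fixed field converge to those of the initial datum. -/
theorem tendsto_scal_initial (hv : IsLerayHopf ν T v₀ v Dv) (hT : 0 < T) (hv₀ : MemH v₀)
    {g : E3 → E3} (hg : MemLp g 2 μT) :
    Tendsto (fun t => scal (v t) g) (𝓝[>] 0) (𝓝 (scal v₀ g)) := by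
  have h1 := hv.initial.mul_const (normSq g)
  rw [zero_mul] at h1
  have hmem : ∀ᶠ t in 𝓝[>] (0 : ℝ), t ∈ Icc 0 T :=
    mem_of_superset (Ioc_mem_nhdsGT hT) Ioc_subset_Icc_self
  have h2 : Tendsto (fun t => (scal (v t) g - scal v₀ g) ^ 2) (𝓝[>] 0) (𝓝 0) := by
    refine squeeze_zero' (Eventually.of_forall fun _ => sq_nonneg _) ?_ h1
    filter_upwards [hmem] with t ht
    have hvt := (hv.memH t ht).memLp
    have h3 : scal (fun x => v t x - v₀ x) g = scal (v t) g - scal v₀ g := by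
      simp only [scal, inner_sub_left]
      exact integral_sub (integrable_inner hvt hg) (integrable_inner hv₀.memLp hg)
    rw [← h3]
    exact sq_scal_le (hvt.sub hv₀.memLp) hg
  have h4 : Tendsto (fun t => |scal (v t) g - scal v₀ g|) (𝓝[>] 0) (𝓝 0) := by
    have := (Real.continuous_sqrt.tendsto 0).comp h2
    simpa only [Function.comp_def, Real.sqrt_sq_eq_abs, Real.sqrt_zero] using this
  rw [tendsto_iff_norm_sub_tendsto_zero]
  exact h4

theorem tendsto_normSq_initial (hv : IsLerayHopf ν T v₀ v Dv) (hT : 0 < T) (hv₀ : MemH v₀) :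
    Tendsto (fun t => normSq (v t)) (𝓝[>] 0) (𝓝 (normSq v₀)) := by
  have h1 := (hv.initial.add ((hv.tendsto_scal_initial hT hv₀ hv₀.memLp).const_mul 2)).sub_const
    (normSq v₀)
  have h2 : 0 + 2 * scal v₀ v₀ - normSq v₀ = normSq v₀ := by rw [scal_self]; ring
  rw [h2] at h1
  refine h1.congr' ?_
  filter_upwards [Ioc_mem_nhdsGT hT] with t ht
  have hvt := (hv.memH t (Ioc_subset_Icc_self ht)).memLp
  have h3 : scal v₀ (v t) = scal (v t) v₀ := by simp only [scal, real_inner_comm]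
  rw [normSq_sub hv₀.memLp hvt, h3]
  ring

/-- The weakly continuous representative takes the initial value `v₀`. -/
theorem normSq_zero (hv : IsLerayHopf ν T v₀ v Dv) (hT : 0 < T) (hv₀ : MemH v₀) :
    normSq (v 0) = normSq v₀ := by
  have h0 : (0 : ℝ) ∈ Icc 0 T := ⟨le_rfl, hT.le⟩
  have key : ∀ g, MemLp g 2 μT → scal (v 0) g = scal v₀ g := fun g hg => by
    have h1 : Tendsto (fun t => scal (v t) g) (𝓝[>] 0) (𝓝 (scal (v 0) g)) := by
      refine ((hv.weak_cont g hg) 0 h0).tendsto.mono_left (nhdsWithin_le_of_mem ?_)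
      exact mem_of_superset (Ioc_mem_nhdsGT hT) Ioc_subset_Icc_self
    exact tendsto_nhds_unique h1 (hv.tendsto_scal_initial hT hv₀ hg)
  have h2 : scal v₀ (v 0) = scal (v 0) v₀ := by simp only [scal, real_inner_comm]
  rw [← scal_self, key _ (hv.memH 0 h0).memLp, h2, key _ hv₀.memLp, scal_self]

end IsLerayHopf

end TorusNS

end

theorem mainTheorem3 (ν T : ℝ) (hν : 0 < ν) (hT : 0 < T)
    (v₀ : TorusNS.E3 → TorusNS.E3) (hv₀ : TorusNS.MemH v₀)
    (v : ℝ → TorusNS.E3 → TorusNS.E3)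
    (Dv : ℝ → TorusNS.E3 → TorusNS.E3 →L[ℝ] TorusNS.E3)
    (hv : TorusNS.IsLerayHopf ν T v₀ v Dv)
    (α : ℝ) (hα : α ∈ Set.Ioo (0 : ℝ) 1)
    (hHolder : ∀ lam ∈ Set.Ioo 0 T, TorusNS.MemLpHolder (2 / (1 + α)) α lam T v) :
    TorusNS.EnergyEquality ν T v₀ v Dv := by
  intro t ht
  rcases ht.1.eq_or_lt with rfl | ht0
  · rw [hv.normSq_zero hT hv₀]
    simp
  have hD : IntervalIntegrable (fun s => TorusNS.scalMat (Dv s) (Dv s)) volume 0 t :=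
    TorusNS.intervalIntegrable_of_integrableOn_Ioo le_rfl ht0.le ht.2 hv.integrableOn_dissipation
  have hmem : ∀ᶠ a in 𝓝[>] (0 : ℝ), a ∈ Ioo 0 t := Ioo_mem_nhdsGT ht0
  have hinc : ∀ᶠ a in 𝓝[>] (0 : ℝ), TorusNS.normSq (v t) - TorusNS.normSq (v a) =
      -(2 * ν * ((∫ s in (0 : ℝ)..t, TorusNS.scalMat (Dv s) (Dv s)) -
        ∫ s in (0 : ℝ)..a, TorusNS.scalMat (Dv s) (Dv s))) := by
    filter_upwards [hmem] with a ha
    rw [hv.energy_increment hν hT hα ha.1 ha.2 ht.2 (hHolder a ⟨ha.1, ha.2.trans_le ht.2⟩),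
      intervalIntegral.integral_const_mul, intervalIntegral.integral_interval_sub_left hD
        (hD.mono_set (by
          rw [uIcc_of_le ha.1.le, uIcc_of_le ht0.le]
          exact Icc_subset_Icc_right ha.2.le))]
    ring
  have hprim : Tendsto (fun a => ∫ s in (0 : ℝ)..a, TorusNS.scalMat (Dv s) (Dv s)) (𝓝[>] 0)
      (𝓝 0) := by
    have h1 := intervalIntegral.continuousOn_primitive_interval' hD left_mem_uIcc 0 left_mem_uIcc
    rw [uIcc_of_le ht0.le, ContinuousWithinAt, intervalIntegral.integral_same] at h1
    exact h1.mono_left (nhdsWithin_le_of_mem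
      (mem_of_superset (Ioo_mem_nhdsGT ht0) Ioo_subset_Icc_self))
  have hL := (hv.tendsto_normSq_initial hT hv₀).const_sub (TorusNS.normSq (v t))
  have hR := ((hprim.const_sub (∫ s in (0 : ℝ)..t, TorusNS.scalMat (Dv s) (Dv s))).const_mul
    (2 * ν)).neg
  have h := tendsto_nhds_unique (hL.congr' hinc) hR
  rw [intervalIntegral.integral_of_le ht0.le, integral_Ioc_eq_integral_Ioo, sub_zero] at h
  linarith
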